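/- **Definitions.** Let $n\ge 1$, $d\ge 2$ and consider $n$ qudits $A_1,\dots,A_n$ with computational basis $|0\rangle,\dots,|d-1\rangle$. A *GWV state* (superposition of a generalized $W$-class state and vacuum) is $$|\psi\rangle=\sqrt p\,|W_n^d\rangle+\sqrt{1-p}\,|0\cdots0\rangle,\qquad |W_n^d\rangle=\sum_{s=1}^{n}\sum_{i=1}^{d-1}a_{si}\,|0\cdots0\,i\,0\cdots0\rangle\ (i\text{ at position }s),$$ with $0\le p\le1$, $a_{si}\in\mathbb C$ and $\sum_{s,i}|a_{si}|^2=1$. For disjoint sets $A,B$ of qudits, $\rho_{AB}=\rho_{A|B}$ is the reduced density matrix of $|\psi\rangle\langle\psi|$ on $A\cup B$, regarded as a bipartite state of $A$ and $B$. The Tsallis-$q$ entanglement ($q>0$, $q\ne1$) of a bipartite pure state $|\phi\rangle_{AB}$ is $$T_q(|\phi\rangle_{AB})=\frac{1-\operatorname{tr}\rho_A^q}{q-1},\qquad \rho_A=\operatorname{tr}_B|\phi\rangle\langle\phi|,$$ and for $q=1$ it is the limiting value $-\operatorname{tr}\rho_A\ln\rho_A$. For a bipartite mixed state, $T_q(\rho_{AB})=\min\sum_i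 p_iT_q(|\phi_i\rangle)$ over all pure state decompositions $\rho_{AB}=\sum_ip_i|\phi_i\rangle\langle\phi_i|$. Powers are written $T_q^\mu(\rho)=(T_q(\rho))^\mu$, with $0^0=1$. **Theorem.** Let $|\psi\rangle$ be an $n$-qudit GWV state, let $P,P_0,\dots,P_{r-1}$ be nonempty, pairwise disjoint sets of its qudits (a partition of a subset of $\{A_1,\dots,A_n\}$), and let $r\ge3$ and $0\le t\le r-3$ be integers. Let $q\in\left[\frac{5-\sqrt{13}}2,\frac{5+\sqrt{13}}2\right]$, $k\ge1$, $\mu\in[2,\infty)$, $\gamma\in[0,\mu]$ be real, and put $$\mathcal K_\gamma=\frac{(1+k)^{\gamma/\mu}-1}{k^{\gamma/\mu}}.$$ If $$k\,T_q^\mu(\rho_{PP_i})\le T_q^\mu(\rho_{P|P_{i+1}\cdots P_{r-1}})\quad\text{for } i=0,1,\dots,t,$$ $$T_q^\mu(\rho_{PP_j})\ge k\,T_q^\mu(\rho_{P|P_{j+1}\cdots P_{r-1}})\quad\text{for } j=t+1,\dots,r-2,$$ then $$T_q^\gamma(\rho_{P|P_0\cdots P_{r-1}})\ \ge\ \sum_{j=0}^{t}\mathcal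 K_\gamma^{\,j}\,T_q^\gamma(\rho_{PP_j})+\mathcal K_\gamma^{\,t+2}\sum_{j=t+1}^{r-2}T_q^\gamma(\rho_{PP_j})+\mathcal K_\gamma^{\,t+1}\,T_q^\gamma(\rho_{PP_{r-1}}).$$ -/

import Mathlib

open Finset

noncomputable section

namespace GWV

/-! ### Pure bipartite states, Tsallis entropy and its convex roof -/

section Bipartite

/-- The marginal on the first factor of the vector `φ`: the matrix of `Tr_β |φ⟩⟨φ|`. -/
def marginal {α β : Type*} [Fintype β] (φ : α × β → ℂ) : Matrix α α ℂ :=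
  fun i i' => ∑ j, φ (i, j) * star (φ (i', j))

theorem marginal_isHermitian {α β : Type*} [Fintype β] (φ : α × β → ℂ) :
    (marginal φ).IsHermitian := by
  ext i i'
  simp [marginal, Matrix.conjTranspose_apply, mul_comm]

/-- The Tsallis-`q` entropy `(1 - tr ρ ^ q) / (q - 1)` of a Hermitian matrix `ρ`, computed from
its eigenvalues; for `q = 1` it is the limiting value, the von Neumann entropy `- tr ρ log ρ`. -/
def tsallisEntropy {α : Type*} [Fintype α] [DecidableEq α] (q : ℝ) {ρ : Matrix α α ℂ}
    (hρ : ρ.IsHermitian) : ℝ :=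
  if q = 1 then ∑ i, Real.negMulLog (hρ.eigenvalues i)
  else (1 - ∑ i, hρ.eigenvalues i ^ q) / (q - 1)

/-- The Tsallis-`q` entanglement of the pure bipartite state `φ`. -/
def pureTsallis {α β : Type*} [Fintype α] [DecidableEq α] [Fintype β] (q : ℝ)
    (φ : α × β → ℂ) : ℝ :=
  tsallisEntropy q (marginal_isHermitian φ)

/-- `ρ = ∑ i, p i |φ i⟩⟨φ i|` with probabilities `p i` and unit vectors `φ i`. -/
structure IsPureDecomposition {ι : Type*} [Fintype ι] {m : ℕ} (ρ : Matrix ι ι ℂ)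
    (p : Fin m → ℝ) (φ : Fin m → ι → ℂ) : Prop where
  nonneg : ∀ i, 0 ≤ p i
  sum_eq_one : ∑ i, p i = 1
  unit : ∀ i, ∑ x, ‖φ i x‖ ^ 2 = 1
  eq_sum : ρ = ∑ i, (p i : ℂ) • Matrix.vecMulVec (φ i) (star (φ i))

/-- The Tsallis-`q` entanglement of the bipartite mixed state `ρ`: the minimal average
Tsallis-`q` entanglement over all pure state decompositions of `ρ`. -/
def mixedTsallis {α β : Type*} [Fintype α] [DecidableEq α] [Fintype β] (q : ℝ)
    (ρ : Matrix (α × β) (α × β) ℂ) : ℝ :=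
  sInf {v : ℝ | ∃ (m : ℕ) (p : Fin m → ℝ) (φ : Fin m → α × β → ℂ),
    IsPureDecomposition ρ p φ ∧ v = ∑ i, p i * pureTsallis q (φ i)}

end Bipartite

/-! ### Generalized W-class states and vacuum, and reduced states -/

section Multipartite

variable {n d : ℕ}

/-- The `n`-qudit vacuum `|0⋯0⟩`. -/
def vacuum [NeZero d] : (Fin n → Fin d) → ℂ := Pi.single 0 1

/-- The generalized W-class vector: the sum over sites `s` and levels `i ≠ 0` of `a s i` times
the basis vector with level `i` at site `s` and level `0` at all other sites. -/
def wVector [NeZero d] (a : Fin n → Fin d → ℂ) : (Fin n → Fin d) → ℂ :=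
  ∑ s : Fin n, ∑ i ∈ univ.filter (fun i : Fin d => i ≠ 0),
    a s i • (Pi.single (Pi.single s i : Fin n → Fin d) 1 : (Fin n → Fin d) → ℂ)

/-- `ψ` is a superposition `√p W + √(1-p) |0⋯0⟩` of a (normalized) generalized W-class state
and the vacuum. -/
def IsGWV [NeZero d] (ψ : (Fin n → Fin d) → ℂ) : Prop :=
  ∃ (p : ℝ) (a : Fin n → Fin d → ℂ), 0 ≤ p ∧ p ≤ 1 ∧
    ∑ s : Fin n, ∑ i ∈ univ.filter (fun i : Fin d => i ≠ 0), ‖a s i‖ ^ 2 = 1 ∧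
    ψ = (Real.sqrt p : ℂ) • wVector a + (Real.sqrt (1 - p) : ℂ) • vacuum

/-- The configuration of all `n` sites that is `x` on `A`, `y` on `B` and `z` elsewhere
(used for disjoint `A` and `B`). -/
def glue (A B : Finset (Fin n)) (x : A → Fin d) (y : B → Fin d)
    (z : {s : Fin n // s ∉ A ∧ s ∉ B} → Fin d) : Fin n → Fin d :=
  fun s => if hA : s ∈ A then x ⟨s, hA⟩ else if hB : s ∈ B then y ⟨s, hB⟩ else z ⟨s, hA, hB⟩

/-- The reduced density matrix `ρ_{A|B}` of `|ψ⟩⟨ψ|` on the disjoint sets of sites `A` and `B`,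
all other sites being traced out, regarded as a bipartite matrix. -/
def reducedState (ψ : (Fin n → Fin d) → ℂ) (A B : Finset (Fin n)) :
    Matrix ((A → Fin d) × (B → Fin d)) ((A → Fin d) × (B → Fin d)) ℂ :=
  fun u v => ∑ z : {s : Fin n // s ∉ A ∧ s ∉ B} → Fin d,
    ψ (glue A B u.1 u.2 z) * star (ψ (glue A B v.1 v.2 z))

/-- `T_q(ρ_{A|B})` for the reduced state of `ψ` on the disjoint sets of sites `A` and `B`. -/
def tsallis (q : ℝ) (ψ : (Fin n → Fin d) → ℂ) (A B : Finset (Fin n)) : ℝ :=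
  mixedTsallis q (reducedState ψ A B)

/-- The union `P_i ∪ P_{i+1} ∪ ⋯ ∪ P_{r-1}` of the blocks with index at least `i`. -/
def tailUnion {r : ℕ} (Q : Fin r → Finset (Fin n)) (i : ℕ) : Finset (Fin n) :=
  (univ.filter (fun j : Fin r => i ≤ (j : ℕ))).biUnion Q

/-- The weight `((1 + k) ^ (γ / μ) - 1) / k ^ (γ / μ)`. -/
def weight (k γ μ : ℝ) : ℝ := ((1 + k) ^ (γ / μ) - 1) / k ^ (γ / μ)

end Multipartite

end GWV

end

noncomputable section

namespace GWV

/-! Everything rests on a closed formula. Let `N s` be the probability that site `s` is excited, and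
write N_A for the sum of `N` over A. For disjoint A and B, T_q(ρ_{A|B}) = f(C) with f =
`concurrenceTsallis q` and C² = 4 N_A N_B (`IsGWV.exists_tsallis_eq`), so the squared concurrence C²
is additive in B.

The formula holds because tracing out the other sites leaves |x⟩⟨x| + g²|00⟩⟨00|, where x is a
W-type vector E plus a vacuum component (`reducedState_gwv`). Every pure state of a decomposition
then has the form s E + u |00⟩. Its marginal has rank at most two, and its concurrence 2|s|²‖α‖‖β‖
does not involve u. The average of |s|² is 1, so the average concurrence is the same for all
decompositions. Jensen's inequality for f gives the lower bound, and two vectors with s = 1 attain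
it (`mixedTsallis_excitationState`).

The analytic core is the convexity of f on [0, 1], which is where the range of q enters, in the form
5q - q² - 3 ≥ 0 (`convexOn_concurrenceTsallis`). Convexity together with f(0) = 0 makes f(C)/C
nondecreasing; since C² is additive, T_q² is superadditive, and therefore so is T_q^μ for μ ≥ 2.

It remains to pass to the exponent γ. Concavity of the power γ/μ shows that if one of two terms
dominates the other by the factor k, the larger one may be weighted by K and the smaller by 1
(`rpow_add_weight_mul_rpow_le`). Splitting off one block at a time, the tail is the larger term up
to index t and the block is the larger one afterwards; the iteration is `weighted_sum_le`. -/

/-! ### The Tsallis entropy of a binary distribution as a function of the concurrence -/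

/-- The contribution of one eigenvalue to the Tsallis-`q` entropy. -/
def entropyTerm (q x : ℝ) : ℝ :=
  if q = 1 then Real.negMulLog x else (x - x ^ q) / (q - 1)

/-- The derivative of `entropyTerm q`. -/
def entropyTermDeriv (q x : ℝ) : ℝ :=
  if q = 1 then -Real.log x - 1 else (1 - q * x ^ (q - 1)) / (q - 1)

/-- The Tsallis-`q` entropy of the distribution `((1 + s) / 2, (1 - s) / 2)` with
`s = √(1 - c ^ 2)`: the Tsallis-`q` entanglement of a two-qubit pure state of concurrence `c`. -/
def concurrenceTsallis (q c : ℝ) : ℝ :=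
  entropyTerm q ((1 + √(1 - c ^ 2)) / 2) + entropyTerm q ((1 - √(1 - c ^ 2)) / 2)

theorem entropyTerm_zero {q : ℝ} (hq : 0 < q) : entropyTerm q 0 = 0 := by
  simp [entropyTerm, Real.zero_rpow hq.ne']

theorem entropyTerm_one (q : ℝ) : entropyTerm q 1 = 0 := by
  simp [entropyTerm]

theorem entropyTerm_nonneg {q x : ℝ} (hx : 0 ≤ x) (hx1 : x ≤ 1) (hq : 0 < q) :
    0 ≤ entropyTerm q x := by
  unfold entropyTerm
  split_ifs with h
  · exact Real.negMulLog_nonneg hx hx1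
  · rcases hx.eq_or_lt with rfl | hx
    · simp [Real.zero_rpow hq.ne']
    rcases lt_or_gt_of_ne h with h | h
    · apply div_nonneg_of_nonpos
      · have := Real.rpow_le_rpow_of_exponent_ge hx hx1 h.le
        rw [Real.rpow_one] at this
        linarith
      · linarith
    · apply div_nonneg
      · have := Real.rpow_le_rpow_of_exponent_ge hx hx1 h.le
        rw [Real.rpow_one] at this
        linarith
      · linarith

theorem continuous_entropyTerm {q : ℝ} (hq : 0 < q) : Continuous (entropyTerm q) := by
  unfold entropyTerm
  split_ifs with h
  · exact Real.continuous_negMulLog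
  · exact (continuous_id.sub (Real.continuous_rpow_const hq.le)).div_const _

theorem hasDerivAt_entropyTerm {q x : ℝ} (hx : 0 < x) :
    HasDerivAt (entropyTerm q) (entropyTermDeriv q x) x := by
  unfold entropyTerm entropyTermDeriv
  split_ifs with h
  · exact Real.hasDerivAt_negMulLog hx.ne'
  · exact ((hasDerivAt_id x).sub (Real.hasDerivAt_rpow_const (Or.inl hx.ne'))).div_const _

theorem hasDerivAt_entropyTermDeriv {q x : ℝ} (hx : 0 < x) :
    HasDerivAt (entropyTermDeriv q) (-(q * x ^ (q - 2))) x := by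
  unfold entropyTermDeriv
  split_ifs with h
  · subst h
    refine ((Real.hasDerivAt_log hx.ne').neg.sub_const 1).congr_deriv ?_
    rw [show (1 : ℝ) - 2 = -1 by norm_num, Real.rpow_neg_one, one_mul]
  · have h' : q - 1 ≠ 0 := sub_ne_zero.2 h
    refine ((((Real.hasDerivAt_rpow_const (p := q - 1) (Or.inl hx.ne')).const_mul q).const_sub
      1).div_const (q - 1)).congr_deriv ?_
    rw [show q - 1 - 1 = q - 2 by ring]
    field_simp

/-- Makes the logarithms below legitimate. The hypothesis forces -1/3 < p < 4, and p < 4 makes the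
discriminant p² - 4p negative when p > 0. -/
theorem quadratics_pos {p s : ℝ} (hp : 0 ≤ 1 + 3 * p - p ^ 2) (hs : 0 ≤ s) (hs1 : s ≤ 1) :
    0 < 1 - p * s + p * s ^ 2 ∧ 0 < 1 + p * s + p * s ^ 2 := by
  have h4 : p < 4 := by nlinarith
  have h3 : -(1 / 3) < p := by nlinarith
  have hss : 0 ≤ s * (1 - s) := mul_nonneg hs (by linarith)
  rcases le_total 0 p with h | h
  · constructor
    · nlinarith [sq_nonneg (2 * s - 1), mul_nonneg h (sq_nonneg (2 * s - 1))]
    · positivity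
  · constructor
    · nlinarith
    · nlinarith

/-- The logarithmic form of the convexity condition for `concurrenceTsallis`. -/
theorem log_ratio_nonneg {p s : ℝ} (hp : 0 ≤ 1 + 3 * p - p ^ 2) (hs : 0 ≤ s) (hs1 : s < 1) :
    0 ≤ p * (p * (Real.log (1 + s) - Real.log (1 - s)) + Real.log (1 - p * s + p * s ^ 2)
      - Real.log (1 + p * s + p * s ^ 2)) := by
  have hd : ∀ x ∈ Set.Ico (0 : ℝ) 1, HasDerivAt (fun s : ℝ =>
      p * (p * (Real.log (1 + s) - Real.log (1 - s)) + Real.log (1 - p * s + p * s ^ 2)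
      - Real.log (1 + p * s + p * s ^ 2)))
      (p * (p * (1 / (1 + x) - (-1) / (1 - x)) + (-p + p * (2 * x)) / (1 - p * x + p * x ^ 2)
      - (p + p * (2 * x)) / (1 + p * x + p * x ^ 2))) x := by
    rintro x ⟨hx, hx1⟩
    obtain ⟨h1, h2⟩ := quadratics_pos hp hx hx1.le
    have e1 : HasDerivAt (fun s : ℝ => 1 + s) 1 x := (hasDerivAt_id x).const_add 1
    have e2 : HasDerivAt (fun s : ℝ => 1 - s) (-1) x := (hasDerivAt_id x).const_sub 1
    have e0 : HasDerivAt (fun s : ℝ => p * s ^ 2) (p * (2 * x)) x := by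
      simpa using (hasDerivAt_pow 2 x).const_mul p
    have e00 : HasDerivAt (fun s : ℝ => p * s) p x := by
      simpa using (hasDerivAt_id x).const_mul p
    have e3 : HasDerivAt (fun s : ℝ => 1 - p * s + p * s ^ 2) (-p + p * (2 * x)) x :=
      (e00.const_sub 1).add e0
    have e4 : HasDerivAt (fun s : ℝ => 1 + p * s + p * s ^ 2) (p + p * (2 * x)) x :=
      (e00.const_add 1).add e0
    exact (((((e1.log (by linarith)).sub (e2.log (by linarith))).const_mul p).add
      (e3.log h1.ne')).sub (e4.log h2.ne')).const_mul p
  -- The expression vanishes at s = 0, so monotonicity on [0, 1) suffices.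
  have hm : MonotoneOn (fun s : ℝ =>
      p * (p * (Real.log (1 + s) - Real.log (1 - s)) + Real.log (1 - p * s + p * s ^ 2)
      - Real.log (1 + p * s + p * s ^ 2))) (Set.Ico (0 : ℝ) 1) := by
    refine monotoneOn_of_deriv_nonneg (convex_Ico 0 1)
      (fun x hx => (hd x hx).continuousAt.continuousWithinAt)
      (fun x hx => (hd x (interior_subset hx)).differentiableAt.differentiableWithinAt) ?_
    intro x hx
    have hx' := interior_subset hx
    rw [(hd x hx').deriv]
    obtain ⟨hx, hx1⟩ := hx'
    obtain ⟨h1, h2⟩ := quadratics_pos hp hx hx1.le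
    have h3 : 0 < 1 + x := by linarith
    have h4 : 0 < 1 - x := by linarith
    have key : p * (p * (1 / (1 + x) - (-1) / (1 - x))
        + (-p + p * (2 * x)) / (1 - p * x + p * x ^ 2)
        - (p + p * (2 * x)) / (1 + p * x + p * x ^ 2)) =
        2 * p ^ 2 * (x ^ 2 * (1 + 3 * p - p ^ 2 + p * (p - 1) * x ^ 2)) /
        ((1 + x) * (1 - x) * ((1 - p * x + p * x ^ 2) * (1 + p * x + p * x ^ 2))) := by
      field_simp
      ring
    rw [key]
    -- The bracket is affine in x²: it is 1 + 3p - p² ≥ 0 at x² = 0 and 1 + 2p > 0 at x² = 1.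
    have h5 : 0 ≤ 1 + 3 * p - p ^ 2 + p * (p - 1) * x ^ 2 := by
      have hp3 : -(1 / 3) < p := by nlinarith
      have hx2 : x ^ 2 ≤ 1 := by nlinarith
      nlinarith [mul_nonneg hp (sub_nonneg.2 hx2), sq_nonneg x]
    positivity
  have := hm (Set.left_mem_Ico.2 one_pos) ⟨hs, hs1⟩ hs
  simpa using this

theorem two_mul_le_log_sub_log {s : ℝ} (hs : 0 ≤ s) (hs1 : s < 1) :
    2 * s ≤ Real.log (1 + s) - Real.log (1 - s) := by
  have h := Real.hasSum_log_sub_log_of_abs_lt_one (x := s) (by rw [abs_of_nonneg hs]; exact hs1)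
  have := h.summable.sum_le_tsum {0} (fun i _ => by positivity)
  rw [h.tsum_eq] at this
  simpa using this

/-- The convexity condition for `concurrenceTsallis` in terms of `s = √(1 - c ^ 2)`. -/
theorem entropyTermDeriv_sub_ge {q s : ℝ} (hq : 0 ≤ 5 * q - q ^ 2 - 3) (hs : 0 < s) (hs1 : s < 1) :
    q * s * (1 - s ^ 2) / 2 * (((1 + s) / 2) ^ (q - 2) + ((1 - s) / 2) ^ (q - 2)) ≤
      entropyTermDeriv q ((1 - s) / 2) - entropyTermDeriv q ((1 + s) / 2) := by
  have ha : 0 < (1 + s) / 2 := by linarith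
  have hb : 0 < (1 - s) / 2 := by linarith
  have hq0 : 0 < q := by nlinarith
  have ea : ((1 + s) / 2) ^ (q - 2) = ((1 + s) / 2) ^ (q - 1) / ((1 + s) / 2) := by
    rw [← Real.rpow_sub_one ha.ne']; ring_nf
  have eb : ((1 - s) / 2) ^ (q - 2) = ((1 - s) / 2) ^ (q - 1) / ((1 - s) / 2) := by
    rw [← Real.rpow_sub_one hb.ne']; ring_nf
  have hl : q * s * (1 - s ^ 2) / 2 * (((1 + s) / 2) ^ (q - 2) + ((1 - s) / 2) ^ (q - 2)) =
      q * s * (((1 + s) / 2) ^ (q - 1) * (1 - s) + ((1 - s) / 2) ^ (q - 1) * (1 + s)) := by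
    rw [ea, eb]
    have : 1 + s ≠ 0 := by linarith
    have : 1 - s ≠ 0 := by linarith
    field_simp
    ring
  rw [hl]
  unfold entropyTermDeriv
  split_ifs with h
  · subst h
    have := two_mul_le_log_sub_log hs.le hs1
    rw [Real.log_div (by linarith) two_ne_zero, Real.log_div (by linarith) two_ne_zero]
    simp only [sub_self, Real.rpow_zero]
    linarith
  -- With p = q - 1 the condition on q becomes 1 + 3p - p² ≥ 0. The claim is a comparison of two
  -- positive products divided by p; taking logarithms turns it into `log_ratio_nonneg`, whose outer
  -- factor p carries the sign for q < 1 and q > 1 alike.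
  · obtain ⟨p, rfl⟩ : ∃ p, q = p + 1 := ⟨q - 1, by ring⟩
    have hp0 : p ≠ 0 := fun h' => h (by simp [h'])
    have hp : 0 ≤ 1 + 3 * p - p ^ 2 := by nlinarith
    obtain ⟨h1, h2⟩ := quadratics_pos hp hs.le hs1.le
    have hlog := log_ratio_nonneg hp hs.le hs1
    simp only [add_sub_cancel_right]
    set a := (1 + s) / 2 with had
    set b := (1 - s) / 2 with hbd
    have hap : 0 < a ^ p := Real.rpow_pos_of_pos ha p
    have hbp : 0 < b ^ p := Real.rpow_pos_of_pos hb p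
    have hlog' : 0 ≤ p * (Real.log (a ^ p * (1 - p * s + p * s ^ 2)) -
        Real.log (b ^ p * (1 + p * s + p * s ^ 2))) := by
      rw [Real.log_mul hap.ne' h1.ne', Real.log_mul hbp.ne' h2.ne', Real.log_rpow ha,
        Real.log_rpow hb, had, hbd, Real.log_div (by linarith) two_ne_zero,
        Real.log_div (by linarith) two_ne_zero]
      refine hlog.trans_eq ?_
      ring
    have hdiv : 0 ≤ (a ^ p * (1 - p * s + p * s ^ 2) - b ^ p * (1 + p * s + p * s ^ 2)) / p := by
      rcases lt_or_gt_of_ne hp0 with hneg | hpos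
      · refine div_nonneg_of_nonpos (sub_nonpos.2 ?_) hneg.le
        refine (Real.log_le_log_iff (by positivity) (by positivity)).1 ?_
        nlinarith
      · refine div_nonneg (sub_nonneg.2 ?_) hpos.le
        refine (Real.log_le_log_iff (by positivity) (by positivity)).1 ?_
        nlinarith
    have e : (1 - (p + 1) * b ^ p) / p - (1 - (p + 1) * a ^ p) / p
        - (p + 1) * s * (a ^ p * (1 - s) + b ^ p * (1 + s)) = (p + 1) *
        ((a ^ p * (1 - p * s + p * s ^ 2) - b ^ p * (1 + p * s + p * s ^ 2)) / p) := by
      field_simp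
      ring
    rw [← sub_nonneg, e]
    exact mul_nonneg hq0.le hdiv

theorem concurrenceTsallis_nonneg {q c : ℝ} (hq : 0 < q) : 0 ≤ concurrenceTsallis q c := by
  have h1 : √(1 - c ^ 2) ≤ 1 := Real.sqrt_le_one.2 (by nlinarith [sq_nonneg c])
  have h0 := Real.sqrt_nonneg (1 - c ^ 2)
  exact add_nonneg (entropyTerm_nonneg (by linarith) (by linarith) hq)
    (entropyTerm_nonneg (by linarith) (by linarith) hq)

theorem concurrenceTsallis_zero {q : ℝ} (hq : 0 < q) : concurrenceTsallis q 0 = 0 := by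
  simp [concurrenceTsallis, entropyTerm_zero hq, entropyTerm_one]

theorem convexOn_concurrenceTsallis {q : ℝ} (hq : 0 ≤ 5 * q - q ^ 2 - 3) :
    ConvexOn ℝ (Set.Icc 0 1) (concurrenceTsallis q) := by
  have hq0 : 0 < q := by nlinarith
  have hS : ∀ c ∈ Set.Ioo (0 : ℝ) 1, 0 < √(1 - c ^ 2) ∧ √(1 - c ^ 2) < 1 ∧
      HasDerivAt (fun c : ℝ => √(1 - c ^ 2)) (-c / √(1 - c ^ 2)) c := by
    rintro c ⟨h0, h1⟩
    have hpos : 0 < 1 - c ^ 2 := by nlinarith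
    refine ⟨Real.sqrt_pos.2 hpos, (Real.sqrt_lt' one_pos).2 (by nlinarith), ?_⟩
    have h := (((hasDerivAt_pow 2 c).const_sub 1).sqrt hpos.ne')
    refine h.congr_deriv ?_
    have := (Real.sqrt_pos.2 hpos).ne'
    field_simp
    norm_num
  refine convexOn_of_hasDerivWithinAt2_nonneg (convex_Icc 0 1)
    (f' := fun c => (entropyTermDeriv q ((1 + √(1 - c ^ 2)) / 2) -
      entropyTermDeriv q ((1 - √(1 - c ^ 2)) / 2)) / 2 * (-c / √(1 - c ^ 2)))
    (f'' := fun c =>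
      (entropyTermDeriv q ((1 - √(1 - c ^ 2)) / 2) - entropyTermDeriv q ((1 + √(1 - c ^ 2)) / 2) -
        q * √(1 - c ^ 2) * (1 - √(1 - c ^ 2) ^ 2) / 2 * (((1 + √(1 - c ^ 2)) / 2) ^ (q - 2) +
          ((1 - √(1 - c ^ 2)) / 2) ^ (q - 2))) / (2 * √(1 - c ^ 2) ^ 3)) ?_ ?_ ?_ ?_
  · have := continuous_entropyTerm hq0
    unfold concurrenceTsallis
    fun_prop
  · intro c hc
    rw [interior_Icc] at hc ⊢
    obtain ⟨h0, h1, hd⟩ := hS c hc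
    have ha : HasDerivAt (fun c : ℝ => (1 + √(1 - c ^ 2)) / 2) (-c / √(1 - c ^ 2) / 2) c :=
      (hd.const_add 1).div_const 2
    have hb : HasDerivAt (fun c : ℝ => (1 - √(1 - c ^ 2)) / 2) (-(-c / √(1 - c ^ 2)) / 2) c :=
      (hd.const_sub 1).div_const 2
    have h := ((hasDerivAt_entropyTerm (q := q) (by linarith : 0 < (1 + √(1 - c ^ 2)) / 2)).comp c
      ha).add ((hasDerivAt_entropyTerm (q := q) (by linarith : 0 < (1 - √(1 - c ^ 2)) / 2)).comp c
      hb)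
    refine (h.congr_deriv ?_).hasDerivWithinAt
    ring
  · intro c hc
    rw [interior_Icc] at hc ⊢
    obtain ⟨h0, h1, hd⟩ := hS c hc
    have ha : HasDerivAt (fun c : ℝ => (1 + √(1 - c ^ 2)) / 2) (-c / √(1 - c ^ 2) / 2) c :=
      (hd.const_add 1).div_const 2
    have hb : HasDerivAt (fun c : ℝ => (1 - √(1 - c ^ 2)) / 2) (-(-c / √(1 - c ^ 2)) / 2) c :=
      (hd.const_sub 1).div_const 2
    have h := ((((hasDerivAt_entropyTermDeriv (q := q)
      (by linarith : 0 < (1 + √(1 - c ^ 2)) / 2)).comp c ha).sub ((hasDerivAt_entropyTermDeriv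
      (q := q) (by linarith : 0 < (1 - √(1 - c ^ 2)) / 2)).comp c hb)).div_const 2).mul
      ((hasDerivAt_id c).neg.div hd h0.ne')
    refine (h.congr_deriv ?_).hasDerivWithinAt
    -- Eliminating c in favour of s = √(1 - c²) leaves an identity that is rational in s.
    have hc2 : c ^ 2 = 1 - √(1 - c ^ 2) ^ 2 := by
      rw [Real.sq_sqrt (by nlinarith [hc.1, hc.2])]; ring
    simp only [Function.comp, id, Pi.sub_apply, Pi.neg_apply, Pi.div_apply]
    generalize entropyTermDeriv q ((1 + √(1 - c ^ 2)) / 2) = A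
    generalize entropyTermDeriv q ((1 - √(1 - c ^ 2)) / 2) = B
    generalize ((1 + √(1 - c ^ 2)) / 2) ^ (q - 2) = A'
    generalize ((1 - √(1 - c ^ 2)) / 2) ^ (q - 2) = B'
    generalize √(1 - c ^ 2) = s at *
    field_simp
    rw [hc2]
    ring
  · intro c hc
    rw [interior_Icc] at hc
    obtain ⟨h0, h1, -⟩ := hS c hc
    exact div_nonneg (sub_nonneg.2 (entropyTermDeriv_sub_ge hq h0 h1)) (by positivity)

/-- The squared Tsallis-`q` entanglement is superadditive in the squared concurrence. -/
theorem concurrenceTsallis_sq_add_sq_le {q x y z : ℝ} (hq : 0 ≤ 5 * q - q ^ 2 - 3)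
    (hx : 0 ≤ x) (hy : 0 ≤ y) (hz : 0 ≤ z) (hz1 : z ≤ 1) (h : x ^ 2 + y ^ 2 = z ^ 2) :
    concurrenceTsallis q x ^ 2 + concurrenceTsallis q y ^ 2 ≤ concurrenceTsallis q z ^ 2 := by
  have hq0 : 0 < q := by nlinarith
  rcases hz.eq_or_lt with rfl | hz
  · have hx0 : x = 0 := by nlinarith
    have hy0 : y = 0 := by nlinarith
    simp [hx0, hy0, concurrenceTsallis_zero hq0]
  -- A convex function vanishing at 0 lies below its chord from 0 to z. After squaring, the factors
  -- x²/z² and y²/z² add up to 1.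
  have key : ∀ w, 0 ≤ w → w ≤ z → concurrenceTsallis q w ^ 2 ≤
      w ^ 2 / z ^ 2 * concurrenceTsallis q z ^ 2 := by
    intro w hw hwz
    have hc := (convexOn_concurrenceTsallis hq).2 (Set.left_mem_Icc.2 zero_le_one)
      (⟨hz.le, hz1⟩ : z ∈ Set.Icc (0 : ℝ) 1) (sub_nonneg.2 ((div_le_one hz).2 hwz))
      (div_nonneg hw hz.le) (sub_add_cancel 1 (w / z))
    simp only [smul_eq_mul, mul_zero, zero_add, concurrenceTsallis_zero hq0,
      div_mul_cancel₀ w hz.ne'] at hc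
    have := pow_le_pow_left₀ (concurrenceTsallis_nonneg hq0) hc 2
    rwa [mul_pow, div_pow] at this
  have h1 := key x hx (by nlinarith)
  have h2 := key y hy (by nlinarith)
  have e : x ^ 2 / z ^ 2 * concurrenceTsallis q z ^ 2 + y ^ 2 / z ^ 2 * concurrenceTsallis q z ^ 2
      = concurrenceTsallis q z ^ 2 := by
    rw [← add_mul, ← add_div, h, div_self (by positivity), one_mul]
  linarith

/-! ### Entropy of matrices of rank at most two -/

/-- Unit trace lets the constant 1 be distributed over the eigenvalues; zero eigenvalues then
contribute nothing when q > 0, so only the nonzero spectrum matters. -/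
theorem tsallisEntropy_eq_sum {X : Type*} [Fintype X] [DecidableEq X] (q : ℝ)
    {M : Matrix X X ℂ} (hM : M.IsHermitian) (h1 : ∑ i, hM.eigenvalues i = 1) :
    tsallisEntropy q hM = ∑ i, entropyTerm q (hM.eigenvalues i) := by
  unfold tsallisEntropy entropyTerm
  split_ifs with h
  · rfl
  · rw [← Finset.sum_div, Finset.sum_sub_distrib, h1]

theorem trace_mul_self_eq_sum_eigenvalues {X : Type*} [Fintype X] [DecidableEq X]
    {M : Matrix X X ℂ} (hM : M.IsHermitian) :
    (M * M).trace = ∑ i, ((hM.eigenvalues i : ℝ) : ℂ) ^ 2 := by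
  conv_lhs => rw [hM.spectral_theorem]
  rw [← map_mul, Unitary.conjStarAlgAut_apply, Matrix.trace_mul_cycle]
  simp [Matrix.diagonal_mul_diagonal, Matrix.trace_diagonal, sq]

/-- A finite family of reals with sum `1`, sum of squares `1 - c ^ 2 / 2` and at most two nonzero
members consists of `(1 ± √(1 - c ^ 2)) / 2` and zeros. -/
theorem sum_comp_eq_of_card_le_two {X : Type*} [Fintype X] {l : X → ℝ} {c : ℝ}
    (hcard : (univ.filter fun i => l i ≠ 0).card ≤ 2) (h1 : ∑ i, l i = 1)
    (h2 : ∑ i, l i ^ 2 = 1 - c ^ 2 / 2) {f : ℝ → ℝ} (hf : f 0 = 0) :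
    ∑ i, f (l i) = f ((1 + √(1 - c ^ 2)) / 2) + f ((1 - √(1 - c ^ 2)) / 2) := by
  classical
  have hred : ∀ g : ℝ → ℝ, g 0 = 0 →
      ∑ i, g (l i) = ∑ i ∈ univ.filter (fun i => l i ≠ 0), g (l i) := by
    intro g hg
    refine (Finset.sum_subset (Finset.subset_univ _) ?_).symm
    intro i _ hi
    have : l i = 0 := by simpa using hi
    rw [this, hg]
  rw [hred f hf]
  have h1' := hred (fun x => x) rfl
  have h2' := hred (fun x => x ^ 2) (by norm_num)
  rw [h1] at h1'
  rw [h2] at h2'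
  generalize (univ.filter fun i => l i ≠ 0) = S at *
  interval_cases hS : S.card
  · rw [Finset.card_eq_zero] at hS
    simp [hS] at h1'
  · obtain ⟨i, rfl⟩ := Finset.card_eq_one.1 hS
    simp only [Finset.sum_singleton] at h1' h2' ⊢
    have hc : 1 - c ^ 2 = 1 := by rw [← h1'] at h2'; linarith
    rw [← h1', hc]
    simp [hf]
  · obtain ⟨i, j, hij, rfl⟩ := Finset.card_eq_two.1 hS
    rw [Finset.sum_pair hij] at h1' h2' ⊢
    -- The discriminant of the quadratic whose roots are the two eigenvalues.
    have hc : 1 - c ^ 2 = (l i - l j) ^ 2 := by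
      have : l i = 1 - l j := by linarith
      rw [this] at h2' ⊢
      linarith
    rw [hc, Real.sqrt_sq_eq_abs]
    rcases abs_cases (l i - l j) with ⟨h, -⟩ | ⟨h, -⟩
    · rw [h, show (1 + (l i - l j)) / 2 = l i by linarith,
        show (1 - (l i - l j)) / 2 = l j by linarith]
    · rw [h, show (1 + -(l i - l j)) / 2 = l j by linarith,
        show (1 - -(l i - l j)) / 2 = l i by linarith, add_comm]

/-! ### Superpositions of a bipartite W-type vector and a product vector -/

section Branch

variable {X Y : Type*} [DecidableEq X] [Fintype Y] [DecidableEq Y]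

/-- The bipartite vector `α ⊗ |y₀⟩ + |x₀⟩ ⊗ β`. -/
def excitation (x₀ : X) (y₀ : Y) (α : X → ℂ) (β : Y → ℂ) : X × Y → ℂ :=
  fun z => α z.1 * (Pi.single y₀ 1 : Y → ℂ) z.2 + (Pi.single x₀ 1 : X → ℂ) z.1 * β z.2

variable {x₀ : X} {y₀ : Y} {α : X → ℂ} {β : Y → ℂ} {a b : ℝ}

/-- Since β vanishes at y₀, the slice y = y₀ contributes the first projector, and every other slice
is a multiple of |x₀⟩; these sum to the second term. -/
theorem marginal_excitation_add (hβ : β y₀ = 0) (hb : ∑ y, ‖β y‖ ^ 2 = b ^ 2) (s u : ℂ) :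
    marginal (s • excitation x₀ y₀ α β + u • (Pi.single (x₀, y₀) 1 : X × Y → ℂ)) =
      Matrix.vecMulVec (s • α + u • (Pi.single x₀ 1 : X → ℂ))
        (star (s • α + u • (Pi.single x₀ 1 : X → ℂ))) +
      (((‖s‖ * b) ^ 2 : ℝ) : ℂ) • Matrix.vecMulVec (Pi.single x₀ 1 : X → ℂ)
        (star (Pi.single x₀ 1 : X → ℂ)) := by
  ext x x'
  have hb' : ∑ y, β y * star (β y) = ((b ^ 2 : ℝ) : ℂ) := by
    rw [← hb]
    push_cast
    exact Finset.sum_congr rfl fun y _ => Complex.mul_conj' _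
  have hs : s * star s = ((‖s‖ ^ 2 : ℝ) : ℂ) := by push_cast; exact Complex.mul_conj' _
  have hD : ∀ x y, (Pi.single (x₀, y₀) 1 : X × Y → ℂ) (x, y) =
      (Pi.single x₀ 1 : X → ℂ) x * (Pi.single y₀ 1 : Y → ℂ) y := by
    intro x y
    simp only [Pi.single_apply, Prod.mk.injEq]
    split_ifs <;> simp_all
  have hterm : ∀ y, (s • excitation x₀ y₀ α β + u • (Pi.single (x₀, y₀) 1 : X × Y → ℂ)) (x, y) *
      star ((s • excitation x₀ y₀ α β + u • (Pi.single (x₀, y₀) 1 : X × Y → ℂ)) (x', y)) =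
      (Pi.single y₀ ((s * α x + u * (Pi.single x₀ 1 : X → ℂ) x) *
        star (s * α x' + u * (Pi.single x₀ 1 : X → ℂ) x')) : Y → ℂ) y +
      s * star s * ((Pi.single x₀ 1 : X → ℂ) x * star ((Pi.single x₀ 1 : X → ℂ) x')) *
        (β y * star (β y)) := by
    intro y
    simp only [Pi.add_apply, Pi.smul_apply, smul_eq_mul, hD, excitation]
    by_cases hy : y = y₀
    · subst hy
      simp [hβ]
    · simp only [Pi.single_eq_of_ne hy, star_mul', star_add]
      ring_nf
      simp
  unfold marginal
  rw [Finset.sum_congr rfl fun y _ => hterm y, Finset.sum_add_distrib, Finset.sum_pi_single',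
    ← Finset.mul_sum, hb', hs]
  simp only [Finset.mem_univ, if_true, Matrix.add_apply, Matrix.vecMulVec_apply, Pi.add_apply,
    Pi.smul_apply, smul_eq_mul, Pi.star_apply, Matrix.smul_apply]
  push_cast
  ring

theorem sum_norm_sq_eq_dotProduct {ι : Type*} [Fintype ι] (v : ι → ℂ) :
    star v ⬝ᵥ v = ((∑ x, ‖v x‖ ^ 2 : ℝ) : ℂ) := by
  push_cast
  exact Finset.sum_congr rfl fun x _ => Complex.conj_mul' _

theorem marginal_trace {X Y : Type*} [Fintype X] [Fintype Y] (φ : X × Y → ℂ) : (marginal φ).trace = ((∑ z, ‖φ z‖ ^ 2 : ℝ) : ℂ) := by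
  rw [Fintype.sum_prod_type]
  push_cast
  exact Finset.sum_congr rfl fun x _ => Finset.sum_congr rfl fun y _ => Complex.mul_conj' _

theorem norm_sq_add_vacuum [Fintype X] (hα : α x₀ = 0) (ha : ∑ x, ‖α x‖ ^ 2 = a ^ 2) (s u : ℂ) :
    star (s • α + u • (Pi.single x₀ 1 : X → ℂ)) ⬝ᵥ (s • α + u • (Pi.single x₀ 1 : X → ℂ)) =
      (((‖s‖ * a) ^ 2 + ‖u‖ ^ 2 : ℝ) : ℂ) := by
  have hs : star s * s = ((‖s‖ ^ 2 : ℝ) : ℂ) := by push_cast; exact Complex.conj_mul' _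
  have hu : star u * u = ((‖u‖ ^ 2 : ℝ) : ℂ) := by push_cast; exact Complex.conj_mul' _
  have hα' : star α ⬝ᵥ α = ((a ^ 2 : ℝ) : ℂ) := by rw [sum_norm_sq_eq_dotProduct, ha]
  have h1 : star α ⬝ᵥ (Pi.single x₀ 1 : X → ℂ) = 0 := by simp [hα]
  have h2 : star (Pi.single x₀ 1 : X → ℂ) ⬝ᵥ α = 0 := by simp [Pi.star_single, hα]
  have h3 : star (Pi.single x₀ 1 : X → ℂ) ⬝ᵥ (Pi.single x₀ 1 : X → ℂ) = 1 := by
    simp [Pi.star_single]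
  simp only [star_add, star_smul, add_dotProduct, dotProduct_add, smul_dotProduct,
    dotProduct_smul, smul_eq_mul, hα', h1, h2, h3]
  have : s * (star s * ((a ^ 2 : ℝ) : ℂ) + star u * 0) + u * (star s * 0 + star u * 1)
      = (star s * s) * ((a ^ 2 : ℝ) : ℂ) + star u * u := by ring
  rw [this, hs, hu]
  push_cast
  ring

/-- The Tsallis entanglement of `s (α ⊗ |y₀⟩ + |x₀⟩ ⊗ β) + u |x₀ y₀⟩`, whose concurrence is
`2 |s|² ‖α‖ ‖β‖`. -/
theorem pureTsallis_excitation_add [Fintype X] {q : ℝ} (hq : 0 < q) (hα : α x₀ = 0) (hβ : β y₀ = 0)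
    (ha : ∑ x, ‖α x‖ ^ 2 = a ^ 2) (hb : ∑ y, ‖β y‖ ^ 2 = b ^ 2) {s u : ℂ}
    (hunit : ∑ z, ‖(s • excitation x₀ y₀ α β + u • (Pi.single (x₀, y₀) 1 : X × Y → ℂ)) z‖ ^ 2
      = 1) :
    pureTsallis q (s • excitation x₀ y₀ α β + u • (Pi.single (x₀, y₀) 1 : X × Y → ℂ)) =
      concurrenceTsallis q (2 * ‖s‖ ^ 2 * (a * b)) ∧
    (‖s‖ * a) ^ 2 + ‖u‖ ^ 2 + (‖s‖ * b) ^ 2 = 1 := by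
  have htr := marginal_trace (s • excitation x₀ y₀ α β + u • (Pi.single (x₀, y₀) 1 : X × Y → ℂ))
  rw [hunit] at htr
  have hM := marginal_excitation_add (x₀ := x₀) (α := α) hβ hb s u
  have hf := norm_sq_add_vacuum hα ha s u
  have hδ : star (Pi.single x₀ 1 : X → ℂ) ⬝ᵥ (Pi.single x₀ 1 : X → ℂ) = 1 := by
    simp [Pi.star_single]
  have hfδ : star (s • α + u • (Pi.single x₀ 1 : X → ℂ)) ⬝ᵥ (Pi.single x₀ 1 : X → ℂ) = star u := by
    simp [hα]
  have hδf : star (Pi.single x₀ 1 : X → ℂ) ⬝ᵥ (s • α + u • (Pi.single x₀ 1 : X → ℂ)) = u := by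
    simp [Pi.star_single, hα]
  have hu : u * star u = ((‖u‖ ^ 2 : ℝ) : ℂ) := by push_cast; exact Complex.mul_conj' _
  have hnorm : (‖s‖ * a) ^ 2 + ‖u‖ ^ 2 + (‖s‖ * b) ^ 2 = 1 := by
    rw [hM, Matrix.trace_add, Matrix.trace_smul, Matrix.trace_vecMulVec, Matrix.trace_vecMulVec,
      dotProduct_comm, hf, dotProduct_comm, hδ, smul_eq_mul, mul_one] at htr
    exact_mod_cast htr
  refine ⟨?_, hnorm⟩
  have hH := marginal_isHermitian
    (s • excitation x₀ y₀ α β + u • (Pi.single (x₀, y₀) 1 : X × Y → ℂ))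
  have h1 : ∑ i, hH.eigenvalues i = 1 := by
    have := hH.trace_eq_sum_eigenvalues
    rw [htr] at this
    have h : ((∑ i, hH.eigenvalues i : ℝ) : ℂ) = ((1 : ℝ) : ℂ) := by
      rw [this]; push_cast; rfl
    exact_mod_cast h
  have h2 : ∑ i, hH.eigenvalues i ^ 2 = 1 - (2 * ‖s‖ ^ 2 * (a * b)) ^ 2 / 2 := by
    have h := (congrArg (fun M => (M * M).trace) hM).symm.trans
      (trace_mul_self_eq_sum_eigenvalues hH)
    simp only [add_mul, mul_add, Matrix.smul_mul, Matrix.mul_smul, Matrix.vecMulVec_mul_vecMulVec,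
      Matrix.trace_add, Matrix.trace_smul, Matrix.trace_vecMulVec, dotProduct_smul, hf, hδ, hfδ,
      hδf, smul_eq_mul] at h
    rw [dotProduct_comm _ (star _), dotProduct_comm _ (star _), dotProduct_comm _ (star _),
      dotProduct_comm _ (star _), hf, hδ, hfδ, hδf] at h
    have h' : ((∑ i, hH.eigenvalues i ^ 2 : ℝ) : ℂ) =
        ((((‖s‖ * a) ^ 2 + ‖u‖ ^ 2) ^ 2 + 2 * ((‖s‖ * b) ^ 2 * ‖u‖ ^ 2) + (‖s‖ * b) ^ 4 : ℝ) : ℂ) := by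
      push_cast
      push_cast at h hu
      rw [← h, ← hu]
      ring
    rw [Complex.ofReal_inj] at h'
    rw [h']
    -- With A = (|s|a)², U = |u|², B = (|s|b)² and A + U + B = 1, the purity (A + U)² + 2BU + B²
    -- equals 1 - 2AB, so U drops out.
    have e : ‖u‖ ^ 2 = 1 - (‖s‖ * a) ^ 2 - (‖s‖ * b) ^ 2 := by linarith
    rw [e]
    ring
  have hcard : (univ.filter fun i => hH.eigenvalues i ≠ 0).card ≤ 2 := by
    rw [← Fintype.card_subtype, ← hH.rank_eq_card_non_zero_eigs, hM]
    -- Factoring through `Fin 2` bounds the rank by two.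
    have : Matrix.vecMulVec (s • α + u • (Pi.single x₀ 1 : X → ℂ))
        (star (s • α + u • (Pi.single x₀ 1 : X → ℂ))) +
      (((‖s‖ * b) ^ 2 : ℝ) : ℂ) • Matrix.vecMulVec (Pi.single x₀ 1 : X → ℂ)
        (star (Pi.single x₀ 1 : X → ℂ)) =
        (Matrix.of fun x i => (![s • α + u • (Pi.single x₀ 1 : X → ℂ),
          (((‖s‖ * b) ^ 2 : ℝ) : ℂ) • (Pi.single x₀ 1 : X → ℂ)] : Fin 2 → X → ℂ) i x) *
        (Matrix.of (![star (s • α + u • (Pi.single x₀ 1 : X → ℂ)),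
          star (Pi.single x₀ 1 : X → ℂ)] : Fin 2 → X → ℂ)) := by
      ext x x'
      simp [Matrix.mul_apply, Fin.sum_univ_two, Matrix.vecMulVec_apply, mul_assoc]
    rw [this]
    exact (Matrix.rank_mul_le_left _ _).trans ((Matrix.rank_le_card_width _).trans (by simp))
  unfold pureTsallis
  rw [tsallisEntropy_eq_sum q _ h1]
  exact sum_comp_eq_of_card_le_two hcard h1 h2 (entropyTerm_zero hq)

end Branch

/-! ### The convex roof of reduced states of W-type vectors -/

section Mixed

theorem dotProduct_vecMulVec_mulVec {ι : Type*} [Fintype ι] (v w : ι → ℂ) :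
    star w ⬝ᵥ (Matrix.vecMulVec v (star v)).mulVec w = ((‖star v ⬝ᵥ w‖ ^ 2 : ℝ) : ℂ) := by
  rw [Matrix.vecMulVec_mulVec]
  simp only [dotProduct_smul, MulOpposite.smul_eq_mul_unop, MulOpposite.unop_op]
  have : star w ⬝ᵥ v = star (star v ⬝ᵥ w) := by
    rw [Matrix.star_dotProduct]
  rw [this]
  push_cast
  exact Complex.conj_mul' _

/-- The quadratic form of a density matrix in terms of a pure state decomposition. -/
theorem IsPureDecomposition.quadraticForm {ι : Type*} [Fintype ι] {m : ℕ} {ρ : Matrix ι ι ℂ}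
    {p : Fin m → ℝ} {φ : Fin m → ι → ℂ} (h : IsPureDecomposition ρ p φ) (w : ι → ℂ) :
    star w ⬝ᵥ ρ.mulVec w = ((∑ i, p i * ‖star (φ i) ⬝ᵥ w‖ ^ 2 : ℝ) : ℂ) := by
  rw [h.eq_sum, Matrix.sum_mulVec, dotProduct_sum]
  push_cast
  refine Finset.sum_congr rfl fun i _ => ?_
  rw [Matrix.smul_mulVec, dotProduct_smul, dotProduct_vecMulVec_mulVec]
  push_cast
  rfl

variable {X Y : Type*} [DecidableEq X] [DecidableEq Y]
  {x₀ : X} {y₀ : Y} {α : X → ℂ} {β : Y → ℂ} {a b : ℝ}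

theorem excitation_vacuum (hα : α x₀ = 0) (hβ : β y₀ = 0) :
    excitation x₀ y₀ α β (x₀, y₀) = 0 := by
  simp [excitation, hα, hβ]

theorem norm_excitation_sq (hα : α x₀ = 0) (hβ : β y₀ = 0) (z : X × Y) :
    ‖excitation x₀ y₀ α β z‖ ^ 2 = ‖α z.1‖ ^ 2 * (Pi.single y₀ 1 : Y → ℝ) z.2 +
      (Pi.single x₀ 1 : X → ℝ) z.1 * ‖β z.2‖ ^ 2 := by
  obtain ⟨x, y⟩ := z
  by_cases hx : x = x₀
  · subst hx
    by_cases hy : y = y₀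
    · subst hy
      simp [excitation, hα, hβ]
    · simp [excitation, hα, hy]
  · by_cases hy : y = y₀
    · subst hy
      simp [excitation, hβ, hx]
    · simp [excitation, hx, hy]

variable [Fintype X] [Fintype Y]

theorem sum_norm_excitation_sq (hα : α x₀ = 0) (hβ : β y₀ = 0)
    (ha : ∑ x, ‖α x‖ ^ 2 = a ^ 2) (hb : ∑ y, ‖β y‖ ^ 2 = b ^ 2) :
    ∑ z, ‖excitation x₀ y₀ α β z‖ ^ 2 = a ^ 2 + b ^ 2 := by
  simp_rw [norm_excitation_sq hα hβ]
  rw [Finset.sum_add_distrib, Fintype.sum_prod_type, Fintype.sum_prod_type]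
  simp only [← Finset.mul_sum, ← Finset.sum_mul, hb, Finset.sum_pi_single', Finset.mem_univ,
    if_true, mul_one, one_mul, ha]

theorem excitation_dotProduct_self (hα : α x₀ = 0) (hβ : β y₀ = 0)
    (ha : ∑ x, ‖α x‖ ^ 2 = a ^ 2) (hb : ∑ y, ‖β y‖ ^ 2 = b ^ 2) :
    star (excitation x₀ y₀ α β) ⬝ᵥ excitation x₀ y₀ α β = ((a ^ 2 + b ^ 2 : ℝ) : ℂ) := by
  rw [sum_norm_sq_eq_dotProduct, sum_norm_excitation_sq hα hβ ha hb]

/-- The matrix `|x⟩⟨x| + g² |x₀ y₀⟩⟨x₀ y₀|`, where `x = α ⊗ |y₀⟩ + |x₀⟩ ⊗ β + c |x₀ y₀⟩`. -/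
def excitationState (x₀ : X) (y₀ : Y) (α : X → ℂ) (β : Y → ℂ) (c g : ℝ) :
    Matrix (X × Y) (X × Y) ℂ :=
  Matrix.vecMulVec (excitation x₀ y₀ α β + (c : ℂ) • (Pi.single (x₀, y₀) 1 : X × Y → ℂ))
      (star (excitation x₀ y₀ α β + (c : ℂ) • (Pi.single (x₀, y₀) 1 : X × Y → ℂ))) +
    ((g ^ 2 : ℝ) : ℂ) • Matrix.vecMulVec (Pi.single (x₀, y₀) 1 : X × Y → ℂ)
      (star (Pi.single (x₀, y₀) 1 : X × Y → ℂ))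

theorem excitationState_quadraticForm (c g : ℝ) (w : X × Y → ℂ) :
    star w ⬝ᵥ (excitationState x₀ y₀ α β c g).mulVec w =
      ((‖star (excitation x₀ y₀ α β) ⬝ᵥ w + c * w (x₀, y₀)‖ ^ 2 + g ^ 2 * ‖w (x₀, y₀)‖ ^ 2 : ℝ)
        : ℂ) := by
  rw [excitationState, Matrix.add_mulVec, dotProduct_add, dotProduct_vecMulVec_mulVec,
    Matrix.smul_mulVec, dotProduct_smul, dotProduct_vecMulVec_mulVec]
  simp [Pi.star_single, star_add, add_dotProduct]

open scoped ComplexOrder in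
/-- The members of a pure state decomposition of `excitationState` lie in the span of the
excitation vector and the vacuum, with average squared weight `1` on the former. -/
theorem IsPureDecomposition.exists_coeff (hα : α x₀ = 0) (hβ : β y₀ = 0)
    (ha : ∑ x, ‖α x‖ ^ 2 = a ^ 2) (hb : ∑ y, ‖β y‖ ^ 2 = b ^ 2) {c g : ℝ} {m : ℕ}
    {p : Fin m → ℝ} {φ : Fin m → X × Y → ℂ}
    (h : IsPureDecomposition (excitationState x₀ y₀ α β c g) p φ) :
    ∃ s u : Fin m → ℂ,
      (∀ i, p i ≠ 0 → φ i = s i • excitation x₀ y₀ α β +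
        u i • (Pi.single (x₀, y₀) 1 : X × Y → ℂ)) ∧
      (a ^ 2 + b ^ 2 ≠ 0 → ∑ i, p i * ‖s i‖ ^ 2 = 1) := by
  have hN := excitation_dotProduct_self hα hβ ha hb
  set E := excitation x₀ y₀ α β with hE
  have hE0 : E (x₀, y₀) = 0 := excitation_vacuum hα hβ
  have hq : ∀ w, ∑ i, p i * ‖star (φ i) ⬝ᵥ w‖ ^ 2 =
      ‖star E ⬝ᵥ w + c * w (x₀, y₀)‖ ^ 2 + g ^ 2 * ‖w (x₀, y₀)‖ ^ 2 := by
    intro w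
    have := (h.quadraticForm w).symm.trans (excitationState_quadraticForm c g w)
    exact_mod_cast this
  have hEz : a ^ 2 + b ^ 2 = 0 → E = 0 := by
    intro h0
    rw [h0, Complex.ofReal_zero] at hN
    exact dotProduct_star_self_eq_zero.1 hN
  refine ⟨fun i => (star E ⬝ᵥ φ i) / ((a ^ 2 + b ^ 2 : ℝ) : ℂ), fun i => φ i (x₀, y₀), ?_, ?_⟩
  · intro i hi
    -- w is the component of φ i orthogonal to E and to the vacuum. The quadratic form of the state
    -- vanishes at w, hence so does ⟨φ i, w⟩, which equals ⟨w, w⟩. If E = 0, the coefficient is 0 by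
    -- the convention for division by zero.
    obtain ⟨w, hw⟩ : ∃ w, w = φ i - ((star E ⬝ᵥ φ i) / ((a ^ 2 + b ^ 2 : ℝ) : ℂ)) • E -
      φ i (x₀, y₀) • (Pi.single (x₀, y₀) 1 : X × Y → ℂ) := ⟨_, rfl⟩
    have hw0 : w (x₀, y₀) = 0 := by simp [hw, hE0]
    have hwE : star E ⬝ᵥ w = 0 := by
      by_cases h0 : a ^ 2 + b ^ 2 = 0
      · simp [hEz h0]
      · rw [hw, dotProduct_sub, dotProduct_sub, dotProduct_smul, dotProduct_smul, hN, smul_eq_mul,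
          div_mul_cancel₀ _ (Complex.ofReal_ne_zero.2 h0)]
        simp [hE0]
    have hs := hq w
    rw [hw0, hwE] at hs
    simp only [mul_zero, add_zero, norm_zero, ne_eq, OfNat.ofNat_ne_zero, not_false_eq_true,
      zero_pow] at hs
    have hz := (Finset.sum_eq_zero_iff_of_nonneg
      (fun i _ => mul_nonneg (h.nonneg i) (sq_nonneg _))).1 hs i (Finset.mem_univ i)
    have hφw : star (φ i) ⬝ᵥ w = 0 := by simpa [hi] using hz
    have hφ : φ i = w + (((star E ⬝ᵥ φ i) / ((a ^ 2 + b ^ 2 : ℝ) : ℂ)) • E +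
      φ i (x₀, y₀) • (Pi.single (x₀, y₀) 1 : X × Y → ℂ)) := by rw [hw]; abel
    have hww : star w ⬝ᵥ w = 0 := by
      rw [hφ, star_add, star_add, star_smul, star_smul, add_dotProduct, add_dotProduct,
        smul_dotProduct, smul_dotProduct, hwE] at hφw
      simpa [Pi.star_single, hw0] using hφw
    have hw00 : w = 0 := dotProduct_star_self_eq_zero.1 hww
    rw [hw00, zero_add] at hφ
    exact hφ
  · intro h0
    -- Testing the quadratic form on E itself gives the average of |⟨φ i, E⟩|² as (a² + b²)².
    have hs := hq E
    rw [hE0, hN] at hs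
    simp only [mul_zero, add_zero, norm_zero, ne_eq, OfNat.ofNat_ne_zero, not_false_eq_true,
      zero_pow, Complex.norm_real, Real.norm_eq_abs, sq_abs] at hs
    have hsi : ∀ i, p i * ‖(star E ⬝ᵥ φ i) / ((a ^ 2 + b ^ 2 : ℝ) : ℂ)‖ ^ 2 =
        p i * ‖star (φ i) ⬝ᵥ E‖ ^ 2 / (a ^ 2 + b ^ 2) ^ 2 := by
      intro i
      have : star E ⬝ᵥ φ i = star (star (φ i) ⬝ᵥ E) := by
        rw [Matrix.star_dotProduct]
      rw [this, norm_div, norm_star, Complex.norm_real, div_pow, Real.norm_eq_abs, sq_abs,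
        mul_div_assoc]
    rw [Finset.sum_congr rfl fun i _ => hsi i, ← Finset.sum_div, hs]
    exact div_self (pow_ne_zero 2 h0)

theorem norm_ofReal_add_mul_I_sq (c g : ℝ) : ‖(c : ℂ) + g * Complex.I‖ ^ 2 = c ^ 2 + g ^ 2 := by
  rw [← Complex.normSq_eq_norm_sq, Complex.normSq_add_mul_I]

theorem sum_norm_sq_excitation_add (hα : α x₀ = 0) (hβ : β y₀ = 0)
    (ha : ∑ x, ‖α x‖ ^ 2 = a ^ 2) (hb : ∑ y, ‖β y‖ ^ 2 = b ^ 2) (u : ℂ) :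
    ∑ z, ‖((1 : ℂ) • excitation x₀ y₀ α β + u • (Pi.single (x₀, y₀) 1 : X × Y → ℂ)) z‖ ^ 2 =
      a ^ 2 + b ^ 2 + ‖u‖ ^ 2 := by
  have hE0 : excitation x₀ y₀ α β (x₀, y₀) = 0 := excitation_vacuum hα hβ
  rw [← sum_norm_excitation_sq hα hβ ha hb]
  have : ∀ z, ‖((1 : ℂ) • excitation x₀ y₀ α β + u • (Pi.single (x₀, y₀) 1 : X × Y → ℂ)) z‖ ^ 2 =
      ‖excitation x₀ y₀ α β z‖ ^ 2 + (Pi.single (x₀, y₀) (‖u‖ ^ 2) : X × Y → ℝ) z := by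
    intro z
    by_cases hz : z = (x₀, y₀)
    · subst hz
      simp [hE0]
    · simp [hz]
  rw [Finset.sum_congr rfl fun z _ => this z, Finset.sum_add_distrib, Finset.sum_pi_single']
  simp

/-- The optimal pure state decomposition of `excitationState`. -/
theorem isPureDecomposition_excitationState (hα : α x₀ = 0) (hβ : β y₀ = 0)
    (ha : ∑ x, ‖α x‖ ^ 2 = a ^ 2) (hb : ∑ y, ‖β y‖ ^ 2 = b ^ 2) {c g : ℝ}
    (h1 : a ^ 2 + b ^ 2 + c ^ 2 + g ^ 2 = 1) :
    IsPureDecomposition (excitationState x₀ y₀ α β c g) ![1 / 2, 1 / 2]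
      ![(1 : ℂ) • excitation x₀ y₀ α β + ((c : ℂ) + g * Complex.I) •
          (Pi.single (x₀, y₀) 1 : X × Y → ℂ),
        (1 : ℂ) • excitation x₀ y₀ α β + ((c : ℂ) + (-g : ℝ) * Complex.I) •
          (Pi.single (x₀, y₀) 1 : X × Y → ℂ)] where
  nonneg i := by fin_cases i <;> norm_num
  sum_eq_one := by norm_num [Fin.sum_univ_two]
  unit i := by
    fin_cases i
    · refine (sum_norm_sq_excitation_add hα hβ ha hb _).trans ?_
      rw [norm_ofReal_add_mul_I_sq]
      linarith
    · refine (sum_norm_sq_excitation_add hα hβ ha hb _).trans ?_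
      rw [norm_ofReal_add_mul_I_sq]
      linarith
  eq_sum := by
    ext z z'
    have hD : star ((Pi.single (x₀, y₀) 1 : X × Y → ℂ) z') =
        (Pi.single (x₀, y₀) 1 : X × Y → ℂ) z' := by
      rw [Pi.single_apply]; split_ifs <;> simp
    simp only [excitationState, Fin.sum_univ_two, Matrix.add_apply, Matrix.smul_apply,
      Matrix.vecMulVec_apply, Matrix.cons_val_zero, Matrix.cons_val_one, Pi.add_apply,
      Pi.smul_apply, Pi.star_apply, smul_eq_mul, star_add, star_mul', hD, one_mul]
    generalize (Pi.single (x₀, y₀) 1 : X × Y → ℂ) z = D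
    generalize (Pi.single (x₀, y₀) 1 : X × Y → ℂ) z' = D'
    generalize excitation x₀ y₀ α β z = F
    generalize star (excitation x₀ y₀ α β z') = F'
    simp only [Complex.star_def, Complex.conj_ofReal, Complex.conj_I]
    push_cast
    -- The cross terms linear in ± g i cancel in the average, leaving only g² on the vacuum.
    linear_combination ((g : ℂ) ^ 2 * D * D') * Complex.I_sq

/-- The Tsallis entanglement of `excitationState` is that of a two-qubit pure state of
concurrence `2 ‖α‖ ‖β‖`. -/
theorem mixedTsallis_excitationState {q : ℝ} (hq : 0 ≤ 5 * q - q ^ 2 - 3)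
    (hα : α x₀ = 0) (hβ : β y₀ = 0) (ha0 : 0 ≤ a) (hb0 : 0 ≤ b)
    (ha : ∑ x, ‖α x‖ ^ 2 = a ^ 2) (hb : ∑ y, ‖β y‖ ^ 2 = b ^ 2) {c g : ℝ}
    (h1 : a ^ 2 + b ^ 2 + c ^ 2 + g ^ 2 = 1) :
    mixedTsallis q (excitationState x₀ y₀ α β c g) = concurrenceTsallis q (2 * (a * b)) := by
  have hq0 : 0 < q := by nlinarith
  refine IsLeast.csInf_eq ⟨?_, ?_⟩
  · have hd := isPureDecomposition_excitationState hα hβ ha hb h1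
    refine ⟨2, _, _, hd, ?_⟩
    have e0 := (pureTsallis_excitation_add hq0 hα hβ ha hb (hd.unit 0)).1
    have e1 := (pureTsallis_excitation_add hq0 hα hβ ha hb (hd.unit 1)).1
    rw [norm_one, one_pow, mul_one] at e0 e1
    rw [Fin.sum_univ_two]
    refine Eq.trans ?_ (congrArg₂ (fun x y => (1 / 2 : ℝ) * x + 1 / 2 * y) e0 e1).symm
    ring
  · rintro v ⟨m, p, φ, hd, rfl⟩
    obtain ⟨s, u, hφ, hsum⟩ := hd.exists_coeff hα hβ ha hb
    have hpure : ∀ i, p i ≠ 0 → pureTsallis q (φ i) =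
        concurrenceTsallis q (2 * ‖s i‖ ^ 2 * (a * b)) ∧
        (‖s i‖ * a) ^ 2 + ‖u i‖ ^ 2 + (‖s i‖ * b) ^ 2 = 1 := by
      intro i hi
      have hu := hd.unit i
      rw [hφ i hi] at hu ⊢
      exact pureTsallis_excitation_add hq0 hα hβ ha hb hu
    by_cases h0 : a ^ 2 + b ^ 2 = 0
    · have ha' : a = 0 := by nlinarith
      rw [ha', zero_mul, mul_zero, concurrenceTsallis_zero hq0]
      refine Finset.sum_nonneg fun i _ => ?_
      by_cases hi : p i = 0
      · rw [hi, zero_mul]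
      · rw [(hpure i hi).1]
        exact mul_nonneg (hd.nonneg i) (concurrenceTsallis_nonneg hq0)
    -- Members of weight zero are unconstrained, so their concurrence is replaced by 0 to stay in
    -- [0, 1].
    · have hJ := (convexOn_concurrenceTsallis hq).map_sum_le (t := Finset.univ) (w := p)
        (p := fun i => if p i = 0 then 0 else 2 * ‖s i‖ ^ 2 * (a * b))
        (fun i _ => hd.nonneg i) hd.sum_eq_one (by
          intro i _
          split_ifs with hi
          · simp
          · have := (hpure i hi).2
            refine ⟨by positivity, ?_⟩
            -- 2|s|²ab ≤ (|s|a)² + (|s|b)² ≤ 1 by normalization.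
            nlinarith [sq_nonneg (‖s i‖ * a - ‖s i‖ * b), sq_nonneg ‖u i‖])
      have e1 : ∑ i, p i • (if p i = 0 then 0 else 2 * ‖s i‖ ^ 2 * (a * b)) = 2 * (a * b) := by
        rw [← mul_one (2 * (a * b)), ← hsum h0, Finset.mul_sum]
        refine Finset.sum_congr rfl fun i _ => ?_
        split_ifs with hi
        · simp [hi]
        · rw [smul_eq_mul]; ring
      rw [e1] at hJ
      refine hJ.trans_eq (Finset.sum_congr rfl fun i _ => ?_)
      by_cases hi : p i = 0
      · simp [hi]
      · rw [if_neg hi, (hpure i hi).1, smul_eq_mul]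

end Mixed

/-! ### Reduced states of superpositions of a W-class state and the vacuum -/

section Reduced

variable {n d : ℕ} {A B : Finset (Fin n)}

theorem glue_inj (hAB : Disjoint A B) {x x' : A → Fin d} {y y' : B → Fin d}
    {z z' : {s : Fin n // s ∉ A ∧ s ∉ B} → Fin d} :
    glue A B x y z = glue A B x' y' z' ↔ x = x' ∧ y = y' ∧ z = z' := by
  constructor
  · intro h
    refine ⟨funext fun s => ?_, funext fun s => ?_, funext fun s => ?_⟩
    · simpa [glue] using congrFun h s
    · have : (s : Fin n) ∉ A := fun hs => Finset.disjoint_left.1 hAB hs s.2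
      simpa [glue, this] using congrFun h s
    · simpa [glue, s.2.1, s.2.2] using congrFun h s
  · rintro ⟨rfl, rfl, rfl⟩
    rfl

theorem single_glue (hAB : Disjoint A B) (x x' : A → Fin d) (y y' : B → Fin d)
    (z z' : {s : Fin n // s ∉ A ∧ s ∉ B} → Fin d) :
    (Pi.single (glue A B x' y' z') 1 : (Fin n → Fin d) → ℂ) (glue A B x y z) =
      (Pi.single x' 1 : (A → Fin d) → ℂ) x * (Pi.single y' 1 : (B → Fin d) → ℂ) y *
        (Pi.single z' 1 : ({s : Fin n // s ∉ A ∧ s ∉ B} → Fin d) → ℂ) z := by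
  simp only [Pi.single_apply, glue_inj hAB]
  by_cases hx : x = x' <;> by_cases hy : y = y' <;> by_cases hz : z = z' <;> simp [hx, hy, hz]

variable [NeZero d]

/-- The W-class vector over an arbitrary set `ι` of sites. -/
def siteVector {ι : Type*} [Fintype ι] [DecidableEq ι] (b : ι → Fin d → ℂ) : (ι → Fin d) → ℂ :=
  ∑ s : ι, ∑ i ∈ univ.filter (fun i : Fin d => i ≠ 0),
    b s i • (Pi.single (Pi.single s i : ι → Fin d) 1 : (ι → Fin d) → ℂ)

section Site

variable {ι : Type*} [Fintype ι] [DecidableEq ι]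

theorem siteVector_apply (b : ι → Fin d → ℂ) (x : ι → Fin d) :
    siteVector b x = ∑ s : ι, ∑ i ∈ univ.filter (fun i : Fin d => i ≠ 0),
      b s i * (Pi.single (Pi.single s i : ι → Fin d) 1 : (ι → Fin d) → ℂ) x := by
  simp [siteVector, Finset.sum_apply]

theorem siteVector_zero (b : ι → Fin d → ℂ) : siteVector b 0 = 0 := by
  rw [siteVector_apply]
  refine Finset.sum_eq_zero fun s _ => Finset.sum_eq_zero fun i hi => ?_
  have hi : i ≠ 0 := by simpa using hi
  rw [Pi.single_apply, if_neg, mul_zero]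
  intro h
  have := congrFun h s
  simp only [Pi.zero_apply, Pi.single_eq_same] at this
  exact hi this.symm

theorem siteVector_single (b : ι → Fin d → ℂ) {s : ι} {i : Fin d} (hi : i ≠ 0) :
    siteVector b (Pi.single s i) = b s i := by
  rw [siteVector_apply, Finset.sum_eq_single s, Finset.sum_eq_single i]
  · simp
  · intro j _ hj
    rw [Pi.single_apply, if_neg, mul_zero]
    intro h
    exact hj (Pi.single_injective s h).symm
  · intro h
    simp [hi] at h
  · intro t _ ht
    refine Finset.sum_eq_zero fun j _ => ?_
    rw [Pi.single_apply, if_neg, mul_zero]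
    intro h
    have := congrFun h s
    rw [Pi.single_eq_same, Pi.single_eq_of_ne ht.symm] at this
    exact hi this
  · simp

theorem siteVector_dotProduct_self (b : ι → Fin d → ℂ) :
    siteVector b ⬝ᵥ star (siteVector b) =
      ∑ s : ι, ∑ i ∈ univ.filter (fun i : Fin d => i ≠ 0), b s i * star (b s i) := by
  -- Only one factor is expanded: each basis vector then reads off a coordinate of the other factor,
  -- and no double sum appears.
  conv_lhs => enter [1]; unfold siteVector
  rw [sum_dotProduct]
  refine Finset.sum_congr rfl fun s _ => ?_
  rw [sum_dotProduct]
  refine Finset.sum_congr rfl fun i hi => ?_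
  rw [smul_dotProduct, single_one_dotProduct, Pi.star_apply,
    siteVector_single b (by simpa using hi), smul_eq_mul]

theorem sum_norm_siteVector_sq (b : ι → Fin d → ℂ) :
    ∑ x, ‖siteVector b x‖ ^ 2 =
      ∑ s : ι, ∑ i ∈ univ.filter (fun i : Fin d => i ≠ 0), ‖b s i‖ ^ 2 := by
  have h := siteVector_dotProduct_self b
  rw [dotProduct_comm, sum_norm_sq_eq_dotProduct] at h
  rw [← Complex.ofReal_inj, h]
  push_cast
  exact Finset.sum_congr rfl fun s _ => Finset.sum_congr rfl fun i _ => Complex.mul_conj' _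

end Site

theorem glue_zero : glue A B (0 : A → Fin d) 0 0 = 0 := by
  funext s
  simp [glue]

theorem glue_single_left (s : A) (i : Fin d) :
    glue A B (Pi.single s i) 0 0 = Pi.single (s : Fin n) i := by
  funext t
  by_cases ht : t = s
  · subst ht
    simp [glue]
  · rw [Pi.single_eq_of_ne ht]
    simp only [glue, Pi.zero_apply]
    split_ifs with h
    · exact Pi.single_eq_of_ne (fun h' => ht (congrArg Subtype.val h')) _
    · rfl
    · rfl

theorem glue_single_right (hAB : Disjoint A B) (s : B) (i : Fin d) :
    glue A B 0 (Pi.single s i) 0 = Pi.single (s : Fin n) i := by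
  funext t
  by_cases ht : t = s
  · subst ht
    have : (s : Fin n) ∉ A := fun hs => Finset.disjoint_left.1 hAB hs s.2
    simp [glue, this]
  · rw [Pi.single_eq_of_ne ht]
    simp only [glue, Pi.zero_apply]
    split_ifs with h h'
    · rfl
    · exact Pi.single_eq_of_ne (fun h' => ht (congrArg Subtype.val h')) _
    · rfl

theorem glue_single_rest (s : {s : Fin n // s ∉ A ∧ s ∉ B}) (i : Fin d) :
    glue A B 0 0 (Pi.single s i) = Pi.single (s : Fin n) i := by
  funext t
  by_cases ht : t = s
  · subst ht
    simp [glue, s.2.1, s.2.2]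
  · rw [Pi.single_eq_of_ne ht]
    simp only [glue, Pi.zero_apply]
    split_ifs with h h'
    · rfl
    · rfl
    · exact Pi.single_eq_of_ne (fun h' => ht (congrArg Subtype.val h')) _

theorem sum_eq_sum_sites {M : Type*} [AddCommMonoid M] (hAB : Disjoint A B) (f : Fin n → M) :
    ∑ s, f s = ∑ s : A, f s + ∑ s : B, f s + ∑ s : {s : Fin n // s ∉ A ∧ s ∉ B}, f s := by
  rw [Finset.sum_coe_sort A f, Finset.sum_coe_sort B f, ← Finset.sum_union hAB,
    ← Finset.sum_add_sum_compl (A ∪ B) f]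
  congr 1
  refine Finset.sum_subtype _ (fun s => ?_) f
  simp

/-- The single excitation sits in A, in B or in the remaining sites, and the other two parts are
then in the vacuum. -/
theorem wVector_glue (hAB : Disjoint A B) (a : Fin n → Fin d → ℂ) (x : A → Fin d) (y : B → Fin d)
    (z : {s : Fin n // s ∉ A ∧ s ∉ B} → Fin d) :
    wVector a (glue A B x y z) =
      siteVector (fun s : A => a s) x * (Pi.single 0 1 : (B → Fin d) → ℂ) y *
        (Pi.single 0 1 : ({s : Fin n // s ∉ A ∧ s ∉ B} → Fin d) → ℂ) z +
      (Pi.single 0 1 : (A → Fin d) → ℂ) x * siteVector (fun s : B => a s) y *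
        (Pi.single 0 1 : ({s : Fin n // s ∉ A ∧ s ∉ B} → Fin d) → ℂ) z +
      (Pi.single 0 1 : (A → Fin d) → ℂ) x * (Pi.single 0 1 : (B → Fin d) → ℂ) y *
        siteVector (fun s : {s : Fin n // s ∉ A ∧ s ∉ B} => a s) z := by
  have h : wVector a (glue A B x y z) = ∑ s : Fin n, ∑ i ∈ univ.filter (fun i : Fin d => i ≠ 0),
      a s i * (Pi.single (Pi.single s i : Fin n → Fin d) 1 : (Fin n → Fin d) → ℂ)
        (glue A B x y z) := siteVector_apply a _
  rw [h, sum_eq_sum_sites hAB]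
  simp only [siteVector_apply, Finset.sum_mul, Finset.mul_sum]
  congr 1
  · congr 1
    · refine Finset.sum_congr rfl fun s _ => Finset.sum_congr rfl fun i _ => ?_
      rw [← glue_single_left (B := B), single_glue hAB]
      ring
    · refine Finset.sum_congr rfl fun s _ => Finset.sum_congr rfl fun i _ => ?_
      rw [← glue_single_right hAB, single_glue hAB]
      ring
  · refine Finset.sum_congr rfl fun s _ => Finset.sum_congr rfl fun i _ => ?_
    rw [← glue_single_rest, single_glue hAB]
    ring

/-- An excitation among the traced-out sites leaves A and B in the vacuum and is orthogonal to the
branch where those sites are empty. It therefore contributes incoherently, with probability g². -/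
theorem reducedState_gwv (hAB : Disjoint A B) (a : Fin n → Fin d → ℂ) (c g : ℝ)
    (hg : ∑ z, ‖siteVector (fun s : {s : Fin n // s ∉ A ∧ s ∉ B} => a s) z‖ ^ 2 = g ^ 2) :
    reducedState (wVector a + (c : ℂ) • vacuum) A B =
      excitationState (0 : A → Fin d) (0 : B → Fin d) (siteVector fun s : A => a s)
        (siteVector fun s : B => a s) c g := by
  ext u v
  set F : (A → Fin d) × (B → Fin d) → ℂ :=
    excitation (0 : A → Fin d) (0 : B → Fin d) (siteVector fun s : A => a s)
        (siteVector fun s : B => a s) +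
      (c : ℂ) • (Pi.single (0, 0) 1 : (A → Fin d) × (B → Fin d) → ℂ) with hF
  set D : (A → Fin d) × (B → Fin d) → ℂ := Pi.single (0, 0) 1 with hD
  have hDe : ∀ w : (A → Fin d) × (B → Fin d), D w =
      (Pi.single 0 1 : (A → Fin d) → ℂ) w.1 * (Pi.single 0 1 : (B → Fin d) → ℂ) w.2 := by
    rintro ⟨x, y⟩
    simp only [hD, Pi.single_apply, Prod.mk.injEq]
    split_ifs <;> simp_all
  have hψ : ∀ w z, (wVector a + (c : ℂ) • vacuum : (Fin n → Fin d) → ℂ) (glue A B w.1 w.2 z) =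
      F w * (Pi.single 0 1 : ({s : Fin n // s ∉ A ∧ s ∉ B} → Fin d) → ℂ) z +
        D w * siteVector (fun s : {s : Fin n // s ∉ A ∧ s ∉ B} => a s) z := by
    intro w z
    rw [Pi.add_apply, wVector_glue hAB, Pi.smul_apply, vacuum, ← glue_zero (A := A) (B := B),
      single_glue hAB, hF, Pi.add_apply, Pi.smul_apply, hDe]
    simp only [excitation, smul_eq_mul]
    ring
  have hterm : ∀ z, (wVector a + (c : ℂ) • vacuum : (Fin n → Fin d) → ℂ) (glue A B u.1 u.2 z) *
      star ((wVector a + (c : ℂ) • vacuum : (Fin n → Fin d) → ℂ) (glue A B v.1 v.2 z)) =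
      (Pi.single 0 (F u * star (F v)) : ({s : Fin n // s ∉ A ∧ s ∉ B} → Fin d) → ℂ) z +
        D u * star (D v) * (siteVector (fun s : {s : Fin n // s ∉ A ∧ s ∉ B} => a s) z *
          star (siteVector (fun s : {s : Fin n // s ∉ A ∧ s ∉ B} => a s) z)) := by
    intro z
    rw [hψ, hψ]
    by_cases hz : z = 0
    · subst hz
      simp [siteVector_zero]
    · simp only [Pi.single_eq_of_ne hz, mul_zero, zero_add, star_mul']
      ring
  have hg' : ∑ z, siteVector (fun s : {s : Fin n // s ∉ A ∧ s ∉ B} => a s) z *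
      star (siteVector (fun s : {s : Fin n // s ∉ A ∧ s ∉ B} => a s) z) = ((g ^ 2 : ℝ) : ℂ) := by
    rw [← hg]
    push_cast
    exact Finset.sum_congr rfl fun z _ => Complex.mul_conj' _
  rw [reducedState, Finset.sum_congr rfl fun z _ => hterm z, Finset.sum_add_distrib,
    Finset.sum_pi_single', ← Finset.mul_sum, hg']
  simp only [Finset.mem_univ, if_true, excitationState, ← hF, Matrix.add_apply, Matrix.smul_apply,
    Matrix.vecMulVec_apply, smul_eq_mul, Pi.star_apply, ← hD]
  ring

/-- The Tsallis-`q` entanglement between two sets of sites of a GWV state is determined by the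
excitation probabilities of the sites. -/
theorem IsGWV.exists_tsallis_eq {ψ : (Fin n → Fin d) → ℂ} (hψ : IsGWV ψ) :
    ∃ N : Fin n → ℝ, (∀ s, 0 ≤ N s) ∧ ∑ s, N s ≤ 1 ∧
      ∀ (q : ℝ), 0 ≤ 5 * q - q ^ 2 - 3 → ∀ A B : Finset (Fin n), Disjoint A B →
        tsallis q ψ A B =
          concurrenceTsallis q (2 * (√(∑ s ∈ A, N s) * √(∑ s ∈ B, N s))) := by
  obtain ⟨p, a, hp0, hp1, ha, rfl⟩ := hψ
  have hb : (√p : ℂ) • wVector a = wVector fun s i => (√p : ℂ) * a s i := by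
    simp only [wVector, Finset.smul_sum, smul_smul]
  set N : Fin n → ℝ := fun s =>
    ∑ i ∈ univ.filter (fun i : Fin d => i ≠ 0), ‖(√p : ℂ) * a s i‖ ^ 2 with hNdef
  have hN0 : ∀ s, 0 ≤ N s := fun s => Finset.sum_nonneg fun i _ => sq_nonneg _
  have hNp : ∑ s, N s = p := by
    simp only [hNdef, norm_mul, mul_pow, Complex.norm_real, Real.norm_eq_abs, sq_abs,
      Real.sq_sqrt hp0, ← Finset.mul_sum, ha, mul_one]
  refine ⟨N, hN0, hNp.le.trans hp1, ?_⟩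
  intro q hq A B hAB
  have hrest : 0 ≤ ∑ s : {s : Fin n // s ∉ A ∧ s ∉ B}, N s := Finset.sum_nonneg fun s _ => hN0 s
  rw [hb, tsallis, reducedState_gwv hAB _ _ (√(∑ s : {s : Fin n // s ∉ A ∧ s ∉ B}, N s))
    (by rw [sum_norm_siteVector_sq, Real.sq_sqrt hrest])]
  have hA : 0 ≤ ∑ s ∈ A, N s := Finset.sum_nonneg fun s _ => hN0 s
  have hB : 0 ≤ ∑ s ∈ B, N s := Finset.sum_nonneg fun s _ => hN0 s
  refine mixedTsallis_excitationState hq (siteVector_zero _) (siteVector_zero _)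
    (Real.sqrt_nonneg _) (Real.sqrt_nonneg _) ?_ ?_ ?_
  · rw [sum_norm_siteVector_sq, Real.sq_sqrt hA, ← Finset.sum_coe_sort A N]
  · rw [sum_norm_siteVector_sq, Real.sq_sqrt hB, ← Finset.sum_coe_sort B N]
  · rw [Real.sq_sqrt hA, Real.sq_sqrt hB, Real.sq_sqrt (sub_nonneg.2 hp1), Real.sq_sqrt hrest,
      ← Finset.sum_coe_sort A N, ← Finset.sum_coe_sort B N]
    have := sum_eq_sum_sites hAB N
    linarith

end Reduced

/-! ### Weighted power inequalities -/

/-- Both v and 1 + u are convex combinations of u and 1 + v, with the two weights interchanged;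
adding the two concavity inequalities gives the claim. -/
theorem rpow_add_one_sub_rpow_anti {θ u v : ℝ} (h0 : 0 ≤ θ) (h1 : θ ≤ 1) (hu : 0 ≤ u)
    (huv : u ≤ v) : (1 + v) ^ θ - v ^ θ ≤ (1 + u) ^ θ - u ^ θ := by
  have hc := Real.concaveOn_rpow h0 h1
  have hpos : 0 < 1 + v - u := by linarith
  have hl : 0 ≤ (v - u) / (1 + v - u) := div_nonneg (by linarith) hpos.le
  have hl' : 0 ≤ 1 / (1 + v - u) := div_nonneg one_pos.le hpos.le
  have hsum : 1 / (1 + v - u) + (v - u) / (1 + v - u) = 1 := by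
    rw [← add_div, ← add_sub_assoc, div_self hpos.ne']
  have hu' : u ∈ Set.Ici (0 : ℝ) := hu
  have hv' : 1 + v ∈ Set.Ici (0 : ℝ) := by
    rw [Set.mem_Ici]; linarith
  have e1 := hc.2 hu' hv' hl' hl hsum
  have e2 := hc.2 hu' hv' hl hl' ((add_comm _ _).trans hsum)
  simp only [smul_eq_mul] at e1 e2
  have p1 : 1 / (1 + v - u) * u + (v - u) / (1 + v - u) * (1 + v) = v := by
    field_simp
    ring
  have p2 : (v - u) / (1 + v - u) * u + 1 / (1 + v - u) * (1 + v) = 1 + u := by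
    field_simp
    ring
  rw [p1] at e1
  rw [p2] at e2
  have p3 : 1 / (1 + v - u) = 1 - (v - u) / (1 + v - u) := by linarith
  rw [p3] at e1 e2
  linarith

theorem weight_nonneg {k γ μ : ℝ} (hk : 1 ≤ k) (hγ : 0 ≤ γ) (hμ : 0 < μ) : 0 ≤ weight k γ μ := by
  refine div_nonneg (sub_nonneg.2 ?_) (Real.rpow_nonneg (by linarith) _)
  exact Real.one_le_rpow (by linarith) (div_nonneg hγ hμ.le)

/-- Put θ = γ/μ, X = x^μ, Y = y^μ. After division by Y^θ the claim concerns (1 + w)^θ - w^θ at w =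
X/Y ≤ 1/k. This is antitone in w, and its value at 1/k is exactly the weight. -/
theorem rpow_add_weight_mul_rpow_le {k γ μ x y z : ℝ} (hk : 1 ≤ k) (hγ : 0 ≤ γ) (hμ : 0 < μ)
    (hγμ : γ ≤ μ) (hx : 0 ≤ x) (hy : 0 ≤ y) (hz : 0 ≤ z) (hxy : k * x ^ μ ≤ y ^ μ)
    (h : x ^ μ + y ^ μ ≤ z ^ μ) : x ^ γ + weight k γ μ * y ^ γ ≤ z ^ γ := by
  have h0 : 0 ≤ γ / μ := div_nonneg hγ hμ.le
  have h1 : γ / μ ≤ 1 := (div_le_one hμ).2 hγμ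
  have hpow : ∀ w : ℝ, 0 ≤ w → w ^ γ = (w ^ μ) ^ (γ / μ) := by
    intro w hw
    rw [← Real.rpow_mul hw, mul_div_cancel₀ _ hμ.ne']
  rw [hpow x hx, hpow y hy, hpow z hz]
  have hX : 0 ≤ x ^ μ := Real.rpow_nonneg hx _
  have hY : 0 ≤ y ^ μ := Real.rpow_nonneg hy _
  refine le_trans ?_ (Real.rpow_le_rpow (add_nonneg hX hY) h h0)
  unfold weight
  generalize x ^ μ = X at *
  generalize y ^ μ = Y at *
  generalize γ / μ = θ at *
  have hk0 : 0 < k := by linarith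
  rcases hY.eq_or_lt with rfl | hYpos
  · have hX0 : X = 0 := by nlinarith
    subst hX0
    -- For θ = 0 the convention 0^0 = 1 is harmless, because the weight is then 0.
    rcases h0.eq_or_lt with rfl | hθ
    · simp
    · simp [Real.zero_rpow hθ.ne']
  · have hle : X / Y ≤ 1 / k := by
      rw [div_le_div_iff₀ hYpos hk0]
      linarith
    have key := rpow_add_one_sub_rpow_anti h0 h1 (div_nonneg hX hY) hle
    have hw : ((1 + k) ^ θ - 1) / k ^ θ = (1 + 1 / k) ^ θ - (1 / k) ^ θ := by
      rw [show 1 + 1 / k = (1 + k) / k by field_simp; ring,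
        Real.div_rpow (by linarith) hk0.le, Real.div_rpow one_pos.le hk0.le, Real.one_rpow, sub_div]
    have hs : (X + Y) ^ θ = (1 + X / Y) ^ θ * Y ^ θ := by
      rw [← Real.mul_rpow (add_nonneg one_pos.le (div_nonneg hX hY)) hY, add_mul,
        div_mul_cancel₀ _ hYpos.ne', one_mul, add_comm]
    have hX' : X ^ θ = (X / Y) ^ θ * Y ^ θ := by
      rw [← Real.mul_rpow (div_nonneg hX hY) hY, div_mul_cancel₀ _ hYpos.ne']
    rw [hw, hs, hX', ← add_mul]
    exact mul_le_mul_of_nonneg_right (by linarith) (Real.rpow_nonneg hY _)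

theorem rpow_add_rpow_le_of_sq {μ x y z : ℝ} (hμ : 2 ≤ μ) (hx : 0 ≤ x) (hy : 0 ≤ y)
    (hz : 0 ≤ z) (h : x ^ 2 + y ^ 2 ≤ z ^ 2) : x ^ μ + y ^ μ ≤ z ^ μ := by
  have hpow : ∀ w : ℝ, 0 ≤ w → w ^ μ = (w ^ 2) ^ (μ / 2) := by
    intro w hw
    rw [← Real.rpow_natCast, ← Real.rpow_mul hw]
    congr 1
    push_cast
    ring
  rw [hpow x hx, hpow y hy, hpow z hz]
  exact (Real.add_rpow_le_rpow_add (sq_nonneg x) (sq_nonneg y) (by linarith)).trans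
    (Real.rpow_le_rpow (by positivity) h (by linarith))

/-- If `K ≥ 0`, `u j + K v (j + 1) ≤ v j` for `j ≤ t` and `K u j + v (j + 1) ≤ v j` for
`t < j < m`, then `v 0` bounds the corresponding weighted sum. -/
theorem weighted_sum_le {K : ℝ} (hK : 0 ≤ K) {u v : ℕ → ℝ} {t m : ℕ} (htm : t + 1 ≤ m)
    (h₁ : ∀ j ≤ t, u j + K * v (j + 1) ≤ v j)
    (h₂ : ∀ j, t + 1 ≤ j → j < m → v (j + 1) + K * u j ≤ v j) :
    ∑ j ∈ range (t + 1), K ^ j * u j + K ^ (t + 2) * ∑ j ∈ Ico (t + 1) m, u j +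
      K ^ (t + 1) * v m ≤ v 0 := by
  -- Up to index t each step multiplies the tail by K, so block j receives K^j.
  have first : ∀ i ≤ t + 1, ∑ j ∈ range i, K ^ j * u j + K ^ i * v i ≤ v 0 := by
    intro i
    induction i with
    | zero => intro; simp
    | succ i ih =>
      intro hi
      have h := mul_le_mul_of_nonneg_left (h₁ i (by omega)) (pow_nonneg hK i)
      rw [Finset.sum_range_succ, pow_succ]
      linarith [ih (by omega)]
  -- From index t + 1 on the tail keeps its coefficient and each block receives a single K.
  -- Multiplied by the accumulated K^(t+1), this gives K^(t+2) for the blocks and K^(t+1) for the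
  -- last tail.
  have second : ∀ i, t + 1 ≤ i → i ≤ m → v i + K * ∑ j ∈ Ico (t + 1) i, u j ≤ v (t + 1) := by
    intro i hi
    induction i, hi using Nat.le_induction with
    | base => intro; simp
    | succ i hi ih =>
      intro him
      rw [Finset.sum_Ico_succ_top hi, mul_add]
      linarith [ih (by omega), h₂ i hi (by omega)]
  have h := mul_le_mul_of_nonneg_left (second m htm le_rfl) (pow_nonneg hK (t + 1))
  have h' := first (t + 1) le_rfl
  rw [show t + 2 = t + 1 + 1 from rfl, pow_succ K (t + 1)]
  linarith

/-! ### Monogamy of the Tsallis entanglement of GWV states -/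

section Monogamy

variable {n d r : ℕ}

theorem tailUnion_eq_union (Q : Fin r → Finset (Fin n)) (i : Fin r) :
    tailUnion Q i = Q i ∪ tailUnion Q ((i : ℕ) + 1) := by
  ext s
  simp only [tailUnion, Finset.mem_biUnion, Finset.mem_filter, Finset.mem_univ, true_and,
    Finset.mem_union]
  constructor
  · rintro ⟨j, hj, hs⟩
    rcases hj.eq_or_lt with h | h
    · left
      rwa [Fin.ext h]
    · exact Or.inr ⟨j, h, hs⟩
  · rintro (hs | ⟨j, hj, hs⟩)
    · exact ⟨i, le_rfl, hs⟩
    · exact ⟨j, by omega, hs⟩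

theorem tailUnion_last (Q : Fin r → Finset (Fin n)) (i : Fin r) (hi : (i : ℕ) + 1 = r) :
    tailUnion Q i = Q i := by
  rw [tailUnion_eq_union]
  have : tailUnion Q ((i : ℕ) + 1) = ∅ := by
    rw [tailUnion, Finset.filter_false_of_mem, Finset.biUnion_empty]
    intro j _
    omega
  rw [this, Finset.union_empty]

variable [NeZero d]

theorem IsGWV.tsallis_nonneg {ψ : (Fin n → Fin d) → ℂ} (hψ : IsGWV ψ) {q : ℝ}
    (hq : 0 ≤ 5 * q - q ^ 2 - 3) {A B : Finset (Fin n)} (hAB : Disjoint A B) :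
    0 ≤ tsallis q ψ A B := by
  obtain ⟨N, -, -, h⟩ := hψ.exists_tsallis_eq
  rw [h q hq A B hAB]
  exact concurrenceTsallis_nonneg (by nlinarith)

/-- The squared concurrences 4 N_A N_B and 4 N_A N_C add up to that of A with B ∪ C. -/
theorem IsGWV.tsallis_sq_add_sq_le {ψ : (Fin n → Fin d) → ℂ} (hψ : IsGWV ψ) {q : ℝ}
    (hq : 0 ≤ 5 * q - q ^ 2 - 3) {A B C : Finset (Fin n)} (hAB : Disjoint A B)
    (hAC : Disjoint A C) (hBC : Disjoint B C) :
    tsallis q ψ A B ^ 2 + tsallis q ψ A C ^ 2 ≤ tsallis q ψ A (B ∪ C) ^ 2 := by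
  obtain ⟨N, hN0, hN1, h⟩ := hψ.exists_tsallis_eq
  have hABC : Disjoint A (B ∪ C) := Finset.disjoint_union_right.2 ⟨hAB, hAC⟩
  have hS : ∀ S : Finset (Fin n), 0 ≤ ∑ s ∈ S, N s := fun S => Finset.sum_nonneg fun s _ => hN0 s
  rw [h q hq A B hAB, h q hq A C hAC, h q hq A (B ∪ C) hABC]
  have hle : ∑ s ∈ A, N s + ∑ s ∈ B ∪ C, N s ≤ 1 := by
    rw [← Finset.sum_union hABC]
    exact (Finset.sum_le_univ_sum_of_nonneg hN0).trans hN1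
  have hA := Real.sq_sqrt (hS A)
  have hU := Real.sq_sqrt (hS (B ∪ C))
  refine concurrenceTsallis_sq_add_sq_le hq (by positivity) (by positivity) (by positivity) ?_ ?_
  -- The concurrence is at most 1 since 2√(N_A N_{B∪C}) ≤ N_A + N_{B∪C} ≤ 1.
  · nlinarith [sq_nonneg (√(∑ s ∈ A, N s) - √(∑ s ∈ B ∪ C, N s))]
  · simp only [mul_pow]
    rw [hA, hU, Real.sq_sqrt (hS B), Real.sq_sqrt (hS C), Finset.sum_union hBC]
    ring

end Monogamy

end GWV

end

theorem theorem4 {n d r t : ℕ} [NeZero d]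
    (ψ : (Fin n → Fin d) → ℂ) (hψ : GWV.IsGWV ψ)
    (P : Finset (Fin n)) (Q : Fin r → Finset (Fin n))
    (hP : P.Nonempty) (hQ : ∀ j, (Q j).Nonempty)
    (hPQ : ∀ j, Disjoint P (Q j)) (hQQ : ∀ i j, i ≠ j → Disjoint (Q i) (Q j))
    (ht : t + 3 ≤ r)
    (q k γ μ : ℝ)
    (hq : q ∈ Set.Icc ((5 - Real.sqrt 13) / 2) ((5 + Real.sqrt 13) / 2))
    (hk : 1 ≤ k) (hγ : γ ∈ Set.Icc 0 μ) (hμ : 2 ≤ μ)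
    (h₁ : ∀ i : Fin r, (i : ℕ) ≤ t →
      k * GWV.tsallis q ψ P (Q i) ^ μ ≤
        GWV.tsallis q ψ P (GWV.tailUnion Q ((i : ℕ) + 1)) ^ μ)
    (h₂ : ∀ j : Fin r, t + 1 ≤ (j : ℕ) → (j : ℕ) ≤ r - 2 →
      k * GWV.tsallis q ψ P (GWV.tailUnion Q ((j : ℕ) + 1)) ^ μ ≤
        GWV.tsallis q ψ P (Q j) ^ μ) :
    (∑ j ∈ Finset.univ.filter (fun j : Fin r => (j : ℕ) ≤ t),
        GWV.weight k γ μ ^ (j : ℕ) * GWV.tsallis q ψ P (Q j) ^ γ)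
      + GWV.weight k γ μ ^ (t + 2) *
        (∑ j ∈ Finset.univ.filter (fun j : Fin r => t + 1 ≤ (j : ℕ) ∧ (j : ℕ) ≤ r - 2),
          GWV.tsallis q ψ P (Q j) ^ γ)
      + GWV.weight k γ μ ^ (t + 1) *
        GWV.tsallis q ψ P (Q ⟨r - 1, by omega⟩) ^ γ
      ≤ GWV.tsallis q ψ P (GWV.tailUnion Q 0) ^ γ := by
  -- The two endpoints are the roots of 5q - q² - 3.
  have hq' : 0 ≤ 5 * q - q ^ 2 - 3 := by
    nlinarith [mul_nonneg (sub_nonneg.2 hq.1) (sub_nonneg.2 hq.2),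
      Real.sq_sqrt (show (0 : ℝ) ≤ 13 by norm_num)]
  have hμ0 : 0 < μ := by linarith
  have hPt : ∀ i, Disjoint P (GWV.tailUnion Q i) := fun i =>
    (Finset.disjoint_biUnion_right _ _ _).2 fun j _ => hPQ j
  have hQt : ∀ i : Fin r, Disjoint (Q i) (GWV.tailUnion Q ((i : ℕ) + 1)) := by
    refine fun i => (Finset.disjoint_biUnion_right _ _ _).2 fun j hj => hQQ i j ?_
    rintro rfl
    simp at hj
  have hT : ∀ i, 0 ≤ GWV.tsallis q ψ P (Q i) := fun i => hψ.tsallis_nonneg hq' (hPQ i)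
  have hτ : ∀ i, 0 ≤ GWV.tsallis q ψ P (GWV.tailUnion Q i) := fun i =>
    hψ.tsallis_nonneg hq' (hPt i)
  have hmono : ∀ i : Fin r, GWV.tsallis q ψ P (Q i) ^ μ +
      GWV.tsallis q ψ P (GWV.tailUnion Q ((i : ℕ) + 1)) ^ μ ≤
      GWV.tsallis q ψ P (GWV.tailUnion Q i) ^ μ := by
    intro i
    refine GWV.rpow_add_rpow_le_of_sq hμ (hT i) (hτ _) (hτ _) ?_
    rw [GWV.tailUnion_eq_union]
    exact hψ.tsallis_sq_add_sq_le hq' (hPQ i) (hPt _) (hQt i)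
  -- The values are extended to all natural indices by 0; only indices below r are used.
  obtain ⟨u, hu⟩ : ∃ u : ℕ → ℝ, ∀ j : Fin r, u j = GWV.tsallis q ψ P (Q j) ^ γ :=
    ⟨fun j => if h : j < r then GWV.tsallis q ψ P (Q ⟨j, h⟩) ^ γ else 0, fun j => by simp⟩
  have key := GWV.weighted_sum_le (GWV.weight_nonneg hk hγ.1 hμ0) (u := u)
    (v := fun j => GWV.tsallis q ψ P (GWV.tailUnion Q j) ^ γ) (t := t) (m := r - 1) (by omega)
    (fun j hj => by
      have hjr : j < r := by omega
      rw [hu ⟨j, hjr⟩]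
      exact GWV.rpow_add_weight_mul_rpow_le hk hγ.1 hμ0 hγ.2 (hT _) (hτ _) (hτ _)
        (h₁ ⟨j, hjr⟩ hj) (hmono ⟨j, hjr⟩))
    (fun j hj hj' => by
      have hjr : j < r := by omega
      rw [hu ⟨j, hjr⟩]
      exact GWV.rpow_add_weight_mul_rpow_le hk hγ.1 hμ0 hγ.2 (hτ _) (hT _) (hτ _)
        (h₂ ⟨j, hjr⟩ hj (by simp only; omega)) ((add_comm _ _).trans_le (hmono ⟨j, hjr⟩)))
  -- The iteration stops at m = r - 1, where the tail is the single last block.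
  have hlast := GWV.tailUnion_last Q ⟨r - 1, by omega⟩ (by simp only; omega)
  simp only at hlast key
  rw [hlast] at key
  refine (le_of_eq ?_).trans key
  simp_rw [← hu]
  congr 2
  · rw [Finset.sum_filter, Fin.sum_univ_eq_sum_range
      (fun j => if j ≤ t then GWV.weight k γ μ ^ j * u j else 0), ← Finset.sum_filter]
    congr 1
    ext j
    simp only [Finset.mem_filter, Finset.mem_range]
    omega
  · rw [Finset.sum_filter, Fin.sum_univ_eq_sum_range
      (fun j => if t + 1 ≤ j ∧ j ≤ r - 2 then u j else 0), ← Finset.sum_filter]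
    congr 2
    ext j
    simp only [Finset.mem_filter, Finset.mem_range, Finset.mem_Ico]
    omega
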